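/- **Setting.** Let $\mathcal S,\mathcal A$ be finite sets, $\rho$ a probability distribution on $\mathcal S$, $\pi_{\rm ref}$ a policy (a map $s\mapsto\pi_{\rm ref}(\cdot|s)$ to distributions on $\mathcal A$) with $\pi_{\rm ref}(a|s)>0$ everywhere, $\beta>0$, $R\ge 1$, and $r^*:\mathcal S\times\mathcal A\to[0,R]$. For a reward $r$ and a policy $\pi$ write $\mathbb E_{\rho,\pi}[r]=\mathbb E_{s\sim\rho,a\sim\pi(\cdot|s)}[r(s,a)]$, $\mathrm{KL}(\pi\|\pi_{\rm ref})=\mathbb E_{s\sim\rho}[\mathrm{KL}(\pi(\cdot|s)\|\pi_{\rm ref}(\cdot|s))]$, $J_\beta(\pi)=\mathbb E_{\rho,\pi}[r^*]-\beta\,\mathrm{KL}(\pi\|\pi_{\rm ref})$, let $\pi^*_r(a|s)\propto\pi_{\rm ref}(a|s)e^{r(s,a)/\beta}$ (the maximizer of the regularized value with reward $r$), and let $\mathrm{Cov}^{\pi'|\pi}=\mathbb E_{s\sim\rho,a\sim\pi'(\cdot|s)}[\pi'(a|s)/\pi(a|s)]$. Let $\sigma(z)=1/(1+e^{-z})$ and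 $a\wedge b=\min\{a,b\}$. A comparison $(s,a,\tilde a,y)$ collected with $\pi$ has $s\sim\rho$, $a\sim\pi(\cdot|s)$, $\tilde a\sim\pi_{\rm ref}(\cdot|s)$, $\Pr[y=1]=\sigma(r^*(s,a)-r^*(s,\tilde a))$, and otherwise $y=0$. Let $\Pi$ be a finite set of policies with $\pi^*_{r^*}\in\Pi$ and $\max_{s,a}|\log(\pi(a|s)/\pi_{\rm ref}(a|s))|\le R/\beta$ for all $\pi\in\Pi$, with convex hull $\mathrm{conv}(\Pi)$. Let $\mathcal R^\Pi$ be the set of rewards $\mathrm{Clip}_{[0,R]}\big[\beta\log\frac{\pi(a|s)}{\pi_{\rm ref}(a|s)}-\min_{a'}\beta\log\frac{\pi(a'|s)}{\pi_{\rm ref}(a'|s)}\big]$, $\pi\in\Pi$. Let $r^1,\dots,r^W:\mathcal S\times\mathcal A\to[0,R]$, $W\ge 0$, be source rewards, $\Delta(w)=J_\beta(\pi^*_{r^*})-J_\beta(\pi^*_{r^w})$ and $\Delta_{\min}=\min_w\Delta(w)$ ($=+\infty$ if $W=0$). Let $\delta\in(0,1)$, and let $T=KN$ with integers $K,N\ge1$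 and $\alpha\in(0,1)$ such that $\alpha N$ is an integer. **TPO.** Step $\tau\in\{1,\dots,T\}$ has inner index $n(\tau)\in\{1,\dots,N\}$, $n(\tau)\equiv\tau \pmod N$. At an *online step* ($n(\tau)\le\alpha N$) the policy $\pi^\tau$ is computed by the (possibly randomized) online algorithm $\mathrm{Alg}_{\rm OL}$, with outputs in $\mathrm{conv}(\Pi)$, from the records of the earlier online steps only; at a *transfer step* ($n(\tau)>\alpha N$) $\pi^\tau$ is chosen as below from the data set $\mathcal D$ of all $|\mathcal D|=\tau-1$ earlier records $(s^i,a^i,\tilde a^i,y^i,\pi^i)$. Then a comparison is collected with $\pi^\tau$. Transfer choice: let $L_{\mathcal D}(r)$ be the average over $\mathcal D$ of $-y\log\sigma(r(s,a)-r(s,\tilde a))-(1-y)\log\sigma(r(s,\tilde a)-r(s,a))$, let $\hat r$ minimize $L_{\mathcal D}$ over $\mathcal R^\Pi$, let $N(w;\mathcal D)$ be the number of $i$ with $\pi^i=\pi^*_{r^w}$, and let $\eta=c(1+e^R)^{-2}\sqrt{\tfrac1{|\mathcal D|}\log\tfrac{|\Pi|T}{\delta}}$ with a constant $c\ge2$.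 Let $(\pi_D,r_D)$ solve $$\max_{\pi\in\mathrm{conv}(\Pi)}\min_{r\in\mathcal R^\Pi}\;L_{\mathcal D}(r)+\eta\big(\mathbb E_{\rho,\pi}[r]-\mathbb E_{\rho,\pi_{\rm ref}}[r]-\beta\,\mathrm{KL}(\pi\|\pi_{\rm ref})\big).$$ Put $$\hat V(\pi^*_{r^w})=\mathbb E_{\rho,\pi^*_{r^w}}[\hat r]-\mathbb E_{\rho,\pi_{\rm ref}}[\hat r]-\beta\,\mathrm{KL}(\pi^*_{r^w}\|\pi_{\rm ref})+16e^{2R}\sqrt{\tfrac{1}{N(w;\mathcal D)}\log\tfrac{|\Pi|WT}{\delta}}$$ ($+\infty$ if $N(w;\mathcal D)=0$) and $$\hat V(\pi_D)=\mathbb E_{\rho,\pi_D}[r_D]-\mathbb E_{\rho,\pi_{\rm ref}}[r_D]-\beta\,\mathrm{KL}(\pi_D\|\pi_{\rm ref})+\tfrac1\eta\big(L_{\mathcal D}(r_D)-L_{\mathcal D}(\hat r)\big)-2ce^{2R}\sqrt{\tfrac1{|\mathcal D|}\log\tfrac{|\Pi|T}{\delta}}.$$ Then $\pi^\tau$ is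 a maximizer of $\hat V$ over $\{\pi^*_{r^1},\dots,\pi^*_{r^W},\pi_D\}$. All ties are broken arbitrarily. **No-regret oracle.** Let $C_{\rm OL}>0$, $c_0\ge1$ be constants and $\mathcal C(\Pi)\ge1$. Assume that $\mathrm{Alg}_{\rm OL}$, run by itself for $\tilde T=\alpha T$ steps, produces with probability at least $1-\delta$ policies $\pi^1,\dots,\pi^{\tilde T}$ with $$\sum_{i\le t}\big(J_\beta(\pi^*_{r^*})-J_\beta(\pi^i)\big)\le C_{\rm OL}Re^{2R}\sqrt{\mathcal C(\Pi)\,t\,\log^{c_0}\tfrac{|\Pi|\tilde T}{\delta}}\qquad\text{for all }1\le t\le\tilde T.$$ **Theorem (Total Regret).** There is a constant $C>0$, depending only on $C_{\rm OL},c_0,c$, such that for every such instance and every run of TPO, with probability at least $1-2\delta$, for all $T/K\le t\le T$ simultaneously, $$\sum_{\tau\le t}\big(J_\beta(\pi^*_{r^*})-J_\beta(\pi^{\tau})\big)\le \mathrm{Reg}^{(t)}_{\rm OL}+\mathrm{Reg}^{(t)}_{\rm Trf},$$ $$\mathrm{Reg}^{(t)}_{\rm OL}=C\,Re^{2R}\sqrt{\alpha\,\mathcal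 C(\Pi)\,t\,\log^{c_0}\tfrac{|\Pi|T}{\delta}},$$ $$\mathrm{Reg}^{(t)}_{\rm Trf}=C\Big(\sum_{\tau\le t:\,n(\tau)>\alpha N}\Delta_{\min}\wedge\iota^{\tau}\;+\;e^{2R}\sqrt{(1-\alpha)Wt\log\tfrac{|\Pi|WT}{\delta}}\;\wedge\sum_{w:\Delta(w)>0}\frac{e^{4R}}{\Delta(w)}\log\tfrac{|\Pi|WT}{\delta}\Big),$$ $$\iota^{\tau}=C\,Re^{2R}\Big(\mathrm{Cov}^{\pi^*_{r^*}|\pi^\tau_{\rm mix}}\wedge\frac{\sqrt{\mathcal C(\Pi)}}{\alpha}\Big)\sqrt{\tfrac1\tau\log^{c_0}\tfrac{|\Pi|T}{\delta}},\qquad \pi^\tau_{\rm mix}=\frac1\tau\sum_{i\le\tau}\pi^i$$ (for $W=0$ the two terms after the sum over $\tau$ are $0$). Moreover, on the same event, the regret of the online steps $\tau\le t$ alone is at most $\mathrm{Reg}^{(t)}_{\rm OL}$, and the regret of the transfer steps $\tau\le t$ alone is at most $\mathrm{Reg}^{(t)}_{\rm Trf}$ with $\iota^{\tau}$ replaced by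 $\iota^{\tau-1}$ (the mixture of the policies in the data set available at step $\tau$). -/

import Mathlib

open MeasureTheory ProbabilityTheory

universe u v w

namespace RLHF

noncomputable section

/-- Policies, as tables of conditional probabilities `π s a = π(a|s)`.
The predicate `IsPolicy` singles out the tables that are genuinely conditional distributions. -/
abbrev Policy (S : Type u) (A : Type v) := S → A → ℝ

/-- Reward functions. -/
abbrev Reward (S : Type u) (A : Type v) := S → A → ℝ

/-- One labelled comparison `(s, a, ã, y)`; `y = true` means that `a` is preferred to `ã`. -/
abbrev Outcome (S : Type u) (A : Type v) := S × A × A × Bool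

/-- One record `(s, a, ã, y, π)` of a data set: the comparison and the policy that produced `a`. -/
abbrev Record (S : Type u) (A : Type v) := Outcome S A × Policy S A

/-- `π(·|s)` is a probability distribution on actions for every state `s`. -/
def IsPolicy {S : Type u} {A : Type v} [Fintype A] (π : Policy S A) : Prop :=
  (∀ s a, 0 ≤ π s a) ∧ ∀ s, ∑ a, π s a = 1

/-- A KL-regularized contextual bandit with preference feedback: prompt distribution `ρ`,
reference policy `πref` (with full support), regularization `β > 0`, and a ground-truth reward
`rstar` with values in `[0, R]`. -/
structure Bandit (S : Type u) (A : Type v) [Fintype S] [Fintype A] where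
  ρ : S → ℝ
  ρ_nonneg : ∀ s, 0 ≤ ρ s
  ρ_sum : ∑ s, ρ s = 1
  πref : Policy S A
  πref_pos : ∀ s a, 0 < πref s a
  πref_sum : ∀ s, ∑ a, πref s a = 1
  β : ℝ
  β_pos : 0 < β
  R : ℝ
  rstar : Reward S A
  rstar_mem : ∀ s a, rstar s a ∈ Set.Icc 0 R

section Basic

variable {S : Type u} {A : Type v} [Fintype S] [Fintype A]

namespace Bandit

/-- `E_{s ∼ ρ, a ∼ π(·|s)}[r(s,a)]`. -/
def expReward (M : Bandit S A) (r : Reward S A) (π : Policy S A) : ℝ :=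
  ∑ s, M.ρ s * ∑ a, π s a * r s a

/-- `KL(π ‖ πref) = E_{s ∼ ρ}[KL(π(·|s) ‖ πref(·|s))]`. -/
def kl (M : Bandit S A) (π : Policy S A) : ℝ :=
  ∑ s, M.ρ s * ∑ a, π s a * Real.log (π s a / M.πref s a)

/-- The KL-regularized value of `π` under the reward `r`. -/
def value (M : Bandit S A) (r : Reward S A) (π : Policy S A) : ℝ :=
  M.expReward r π - M.β * M.kl π

/-- `J_β(π)`, the regularized value under the ground-truth reward. -/
def J (M : Bandit S A) (π : Policy S A) : ℝ := M.value M.rstar π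

/-- The optimal policy `π*_r` of the regularized objective with reward `r`, in closed form
`π*_r(a|s) ∝ πref(a|s) exp(r(s,a)/β)`; it is optimal by `isMaxOn_optPolicy`. -/
def optPolicy (M : Bandit S A) (r : Reward S A) : Policy S A := fun s a =>
  M.πref s a * Real.exp (r s a / M.β) / ∑ b, M.πref s b * Real.exp (r s b / M.β)

/-- `J_β(π*_{r*}) - J_β(π)`. -/
def gap (M : Bandit S A) (π : Policy S A) : ℝ := M.J (M.optPolicy M.rstar) - M.J π

/-- The coverage coefficient `Cov^{π' | π} = E_{s ∼ ρ, a ∼ π'(·|s)}[π'(a|s) / π(a|s)]`. -/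
def cov (M : Bandit S A) (π' π : Policy S A) : ℝ :=
  ∑ s, M.ρ s * ∑ a, π' s a * (π' s a / π s a)

/-- The Bradley-Terry probability of the label `y` under the reward `r`:
`σ(r(s,a) - r(s,ã))` for `y = 1`, and `σ(r(s,ã) - r(s,a))` for `y = 0`. -/
def btProb (r : Reward S A) : Outcome S A → ℝ
  | (s, a, a', true) => Real.sigmoid (r s a - r s a')
  | (s, a, a', false) => Real.sigmoid (r s a' - r s a)

/-- The probability of the comparison `(s, a, ã, y)` drawn from `ρ × π × πref × P_{r*}`. -/
def outcomeProb (M : Bandit S A) (π : Policy S A) (z : Outcome S A) : ℝ :=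
  M.ρ z.1 * π z.1 z.2.1 * M.πref z.1 z.2.2.1 * btProb M.rstar z

/-- A finite policy class which (I) contains `π*_{r*}` and (II) consists of policies with
`max_{s,a} |log (π(a|s) / πref(a|s))| ≤ R/β`. -/
structure GoodClass (M : Bandit S A) (Pi : Finset (Policy S A)) : Prop where
  realizable : M.optPolicy M.rstar ∈ Pi
  isPolicy : ∀ π ∈ Pi, IsPolicy π
  ratio : ∀ π ∈ Pi, ∀ s a, 0 < π s a ∧ |Real.log (π s a / M.πref s a)| ≤ M.R / M.β

/-- The convex hull `conv(Π)`. -/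
def hull (Pi : Finset (Policy S A)) : Set (Policy S A) := convexHull ℝ (Pi : Set (Policy S A))

/-- The reward
`Clip_{[0,R]}[β log (π(a|s)/πref(a|s)) - min_{a'} β log (π(a'|s)/πref(a'|s))]` of a policy. -/
def rewardOf (M : Bandit S A) (π : Policy S A) : Reward S A := fun s a =>
  max 0 (min M.R (M.β * Real.log (π s a / M.πref s a)
    - ⨅ a', M.β * Real.log (π s a' / M.πref s a')))

/-- The reward class `R^Π`. -/
def rewardClass (M : Bandit S A) (Pi : Finset (Policy S A)) : Set (Reward S A) :=
  M.rewardOf '' (Pi : Set (Policy S A))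

/-- For every reward `r`, `π*_r` maximizes the regularized value among all policies. -/
theorem isMaxOn_optPolicy (M : Bandit S A) (r : Reward S A) :
    IsPolicy (M.optPolicy r) ∧ IsMaxOn (M.value r) {π | IsPolicy π} (M.optPolicy r) := by
  have hβ := M.β_pos
  have hne : ∀ s : S, Nonempty A := by
    intro s
    by_contra h
    rw [not_nonempty_iff] at h
    have := M.πref_sum s
    simp at this
  have hZ : ∀ s, 0 < ∑ b, M.πref s b * Real.exp (r s b / M.β) := by
    intro s
    have := hne s
    exact Finset.sum_pos (fun b _ => mul_pos (M.πref_pos s b) (Real.exp_pos _))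
      Finset.univ_nonempty
  have hg : ∀ s a, 0 < M.optPolicy r s a := fun s a =>
    div_pos (mul_pos (M.πref_pos s a) (Real.exp_pos _)) (hZ s)
  have hg1 : ∀ s, ∑ a, M.optPolicy r s a = 1 := by
    intro s
    simp only [optPolicy]
    rw [← Finset.sum_div, div_self (hZ s).ne']
  have hlog : ∀ s a, r s a - M.β * Real.log (M.optPolicy r s a / M.πref s a)
      = M.β * Real.log (∑ b, M.πref s b * Real.exp (r s b / M.β)) := by
    intro s a
    have h1 : M.optPolicy r s a / M.πref s a
        = Real.exp (r s a / M.β) / ∑ b, M.πref s b * Real.exp (r s b / M.β) := by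
      have := (M.πref_pos s a).ne'
      simp only [optPolicy]
      field_simp
    rw [h1, Real.log_div (Real.exp_pos _).ne' (hZ s).ne', Real.log_exp]
    field_simp
    ring
  have hval : ∀ π : Policy S A, M.value r π = ∑ s, M.ρ s * ∑ a,
      π s a * (r s a - M.β * Real.log (π s a / M.πref s a)) := by
    intro π
    simp only [value, expReward, kl, Finset.mul_sum, ← Finset.sum_sub_distrib]
    refine Finset.sum_congr rfl fun s _ => Finset.sum_congr rfl fun a _ => ?_
    ring
  refine ⟨⟨fun s a => (hg s a).le, hg1⟩, ?_⟩
  intro π hπ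
  obtain ⟨h0, h1⟩ := hπ
  change M.value r π ≤ M.value r (M.optPolicy r)
  rw [hval, hval]
  refine Finset.sum_le_sum fun s _ => mul_le_mul_of_nonneg_left ?_ (M.ρ_nonneg s)
  have hR : ∑ a, M.optPolicy r s a
        * (r s a - M.β * Real.log (M.optPolicy r s a / M.πref s a))
      = M.β * Real.log (∑ b, M.πref s b * Real.exp (r s b / M.β)) := by
    rw [Finset.sum_congr rfl fun a _ => by rw [hlog s a], ← Finset.sum_mul, hg1, one_mul]
  rw [hR]
  have hterm : ∀ a, π s a * (r s a - M.β * Real.log (π s a / M.πref s a))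
      ≤ π s a * (M.β * Real.log (∑ b, M.πref s b * Real.exp (r s b / M.β)))
        + M.β * (M.optPolicy r s a - π s a) := by
    intro a
    rw [← hlog s a]
    rcases (h0 s a).eq_or_lt with h | h
    · rw [← h]
      have := mul_pos hβ (hg s a)
      simp
      linarith
    · have hd := Real.log_le_sub_one_of_pos (div_pos (hg s a) h)
      rw [Real.log_div (hg s a).ne' h.ne'] at hd
      rw [Real.log_div h.ne' (M.πref_pos s a).ne',
        Real.log_div (hg s a).ne' (M.πref_pos s a).ne']
      have h2 : π s a * (Real.log (M.optPolicy r s a) - Real.log (π s a))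
          ≤ M.optPolicy r s a - π s a := by
        calc π s a * (Real.log (M.optPolicy r s a) - Real.log (π s a))
            ≤ π s a * (M.optPolicy r s a / π s a - 1) :=
              mul_le_mul_of_nonneg_left hd h.le
          _ = M.optPolicy r s a - π s a := by field_simp
      nlinarith [mul_le_mul_of_nonneg_left h2 hβ.le]
  refine (Finset.sum_le_sum fun a _ => hterm a).trans (le_of_eq ?_)
  rw [Finset.sum_add_distrib, ← Finset.sum_mul, ← Finset.mul_sum, Finset.sum_sub_distrib,
    h1, hg1]
  ring

end Bandit

/-- The uniform mixture `(1/d) ∑_{i < d} π_i` of the first `d` policies. -/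
def mix (π : ℕ → Policy S A) (d : ℕ) : Policy S A := fun s a =>
  (1 / (d : ℝ)) * ∑ i ∈ Finset.range d, π i s a

/-- The average negative log-likelihood `L_D(r)` on the first `d` comparisons. -/
def nll (x : ℕ → Outcome S A) (d : ℕ) (r : Reward S A) : ℝ :=
  (1 / (d : ℝ)) * ∑ i ∈ Finset.range d, -Real.log (Bandit.btProb r (x i))

/-- The inputs of TPO: policy class, `W` source rewards, block size `N`, number `m = α N` of online
iterations in each block, number `K` of blocks, confidence `δ`, and the numerical constant `c`
in the step size and in the lower confidence bound. -/
structure Config (S : Type u) (A : Type v) where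
  Pi : Finset (Policy S A)
  W : ℕ
  src : Fin W → Reward S A
  N : ℕ
  m : ℕ
  K : ℕ
  δ : ℝ
  c : ℝ

namespace Config

/-- The total number of iterations `T = K N`. -/
def T (P : Config S A) : ℕ := P.K * P.N

/-- The fraction `α` of iterations given to the online learner. -/
def α (P : Config S A) : ℝ := (P.m : ℝ) / (P.N : ℝ)

/-- `log (|Π| T / δ)`. -/
def logT (P : Config S A) : ℝ := Real.log ((P.Pi.card : ℝ) * (P.T : ℝ) / P.δ)

/-- `log (|Π| W T / δ)`. -/
def logWT (P : Config S A) : ℝ :=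
  Real.log ((P.Pi.card : ℝ) * (P.W : ℝ) * (P.T : ℝ) / P.δ)

/-- The value gap `Δ(w) = J_β(π*_{r*}) - J_β(π*_{r^w})` of a source reward. -/
def Δ (P : Config S A) (M : Bandit S A) (i : Fin P.W) : ℝ := M.gap (M.optPolicy (P.src i))

/-- `min_w Δ(w) ∧ x`, where the minimum over no sources is `+∞`. -/
def capΔ (P : Config S A) (M : Bandit S A) (x : ℝ) : ℝ :=
  (min (⨅ i : Fin P.W, ((P.Δ M i : ℝ) : EReal)) (x : EReal)).toReal

open Classical in
/-- `N(w; D)`: how many of the first `d` policies equal `π*_{r^w}`. -/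
def visits (P : Config S A) (M : Bandit S A) (π : ℕ → Policy S A) (d : ℕ) (i : Fin P.W) : ℕ :=
  ((Finset.range d).filter fun j => π j = M.optPolicy (P.src i)).card

/-- The step size `η = c (1 + e^R)⁻² √(log(|Π|T/δ) / |D|)`. -/
def eta (P : Config S A) (M : Bandit S A) (d : ℕ) : ℝ :=
  P.c * ((1 + Real.exp M.R) ^ 2)⁻¹ * Real.sqrt (1 / (d : ℝ) * P.logT)

/-- `r` is a maximum likelihood estimator in `R^Π` for the first `d` comparisons. -/
def IsMLE (P : Config S A) (M : Bandit S A) (x : ℕ → Outcome S A) (d : ℕ)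
    (r : Reward S A) : Prop :=
  r ∈ M.rewardClass P.Pi ∧ ∀ r' ∈ M.rewardClass P.Pi, nll x d r ≤ nll x d r'

/-- The RPO objective
`L_D(r) + η (E_{ρ,π}[r] - E_{ρ,πref}[r] - β KL(π ‖ πref))`. -/
def rpoObj (P : Config S A) (M : Bandit S A) (x : ℕ → Outcome S A) (d : ℕ)
    (π : Policy S A) (r : Reward S A) : ℝ :=
  nll x d r + P.eta M d * (M.expReward r π - M.expReward r M.πref - M.β * M.kl π)

/-- `(π, r)` solves `max_{π ∈ conv(Π)} min_{r ∈ R^Π}` of the RPO objective. -/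
def IsRPO (P : Config S A) (M : Bandit S A) (x : ℕ → Outcome S A) (d : ℕ)
    (π : Policy S A) (r : Reward S A) : Prop :=
  π ∈ Bandit.hull P.Pi ∧ r ∈ M.rewardClass P.Pi ∧
    (∀ r' ∈ M.rewardClass P.Pi, P.rpoObj M x d π r ≤ P.rpoObj M x d π r') ∧
    ∀ π' ∈ Bandit.hull P.Pi, ∃ r' ∈ M.rewardClass P.Pi,
      P.rpoObj M x d π' r' ≤ P.rpoObj M x d π r

/-- The optimistic value estimate of `π*_{r^w}`; it is `+∞` if `N(w; D) = 0`. -/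
def estSrc (P : Config S A) (M : Bandit S A) (π : ℕ → Policy S A) (d : ℕ)
    (rmle : Reward S A) (i : Fin P.W) : EReal :=
  if P.visits M π d i = 0 then ⊤ else
    ((M.expReward rmle (M.optPolicy (P.src i)) - M.expReward rmle M.πref
      - M.β * M.kl (M.optPolicy (P.src i))
      + 16 * Real.exp (2 * M.R) * Real.sqrt (1 / (P.visits M π d i : ℝ) * P.logWT) : ℝ) : EReal)

/-- The pessimistic value estimate of the distilled policy. -/
def estDstl (P : Config S A) (M : Bandit S A) (x : ℕ → Outcome S A) (d : ℕ)
    (rmle : Reward S A) (πD : Policy S A) (rD : Reward S A) : ℝ :=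
  M.expReward rD πD - M.expReward rD M.πref - M.β * M.kl πD
    + 1 / P.eta M d * nll x d rD - 1 / P.eta M d * nll x d rmle
    - 2 * P.c * Real.exp (2 * M.R) * Real.sqrt (1 / (d : ℝ) * P.logT)

/-- `p` is a possible output of transfer policy selection on the data set made of the first `d`
records: a policy with the largest estimated value among the optimal policies of the sources and
the distilled policy (all arg max and arg min may break ties arbitrarily). -/
def IsTPS (P : Config S A) (M : Bandit S A) (x : ℕ → Outcome S A) (π : ℕ → Policy S A) (d : ℕ)
    (p : Policy S A) : Prop :=
  ∃ (rmle : Reward S A) (πD : Policy S A) (rD : Reward S A),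
    P.IsMLE M x d rmle ∧ P.IsRPO M x d πD rD ∧
    ((p = πD ∧ ∀ i, P.estSrc M π d rmle i ≤ (P.estDstl M x d rmle πD rD : EReal)) ∨
     ∃ i, p = M.optPolicy (P.src i) ∧
      (∀ i', P.estSrc M π d rmle i' ≤ P.estSrc M π d rmle i) ∧
      (P.estDstl M x d rmle πD rD : EReal) ≤ P.estSrc M π d rmle i)

/-- The (zero-based) iteration at which the `j`-th online policy is computed: the online iterations
are the first `m` ones in each block of length `N`. -/
def onlineTime (P : Config S A) (j : ℕ) : ℕ := (j / P.m) * P.N + j % P.m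

/-- The (zero-based) online iterations among the first `t` ones. -/
def onlineSteps (P : Config S A) (t : ℕ) : Finset ℕ :=
  (Finset.range t).filter fun i => i % P.N < P.m

/-- The (zero-based) transfer iterations among the first `t` ones. -/
def transferSteps (P : Config S A) (t : ℕ) : Finset ℕ :=
  (Finset.range t).filter fun i => P.m ≤ i % P.N

end Config

end Basic

section Interaction

variable {S : Type u} {A : Type v} [Fintype S] [Fintype A]
  [MeasurableSpace S] [MeasurableSpace A]

/-- Sequential data generation for `n` iterations: policy `π i` is chosen between the times of the
information `ℋ i` (the past) and `𝒢 i` (the past and `π i`), and then the comparison `x i` is drawn,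
given `𝒢 i`, from `ρ × π i × πref × P_{r*}`. -/
structure IsInteraction {Ω : Type w} [mΩ : MeasurableSpace Ω] (M : Bandit S A) (n : ℕ)
    (μ : Measure Ω) (ℋ 𝒢 : ℕ → MeasurableSpace Ω)
    (π : ℕ → Ω → Policy S A) (x : ℕ → Ω → Outcome S A) : Prop where
  le_choice : ∀ i, ℋ i ≤ 𝒢 i
  le_next : ∀ i, 𝒢 i ≤ ℋ (i + 1)
  le_ambient : ∀ i, ℋ i ≤ mΩ
  measurable_policy : ∀ i < n, Measurable[𝒢 i] (π i)
  measurable_outcome : ∀ i < n, Measurable[ℋ (i + 1)] (x i)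
  outcome_law : ∀ i < n, ∀ z : Outcome S A,
    μ⟦x i ⁻¹' {z} | 𝒢 i⟧ =ᵐ[μ] fun ω => M.outcomeProb (π i ω) z

/-- An online learning algorithm with outputs in `conv(Π)`: given the `j` records collected so far,
it draws the next policy from a distribution on `conv(Π)`. -/
structure OnlineAlg (Pi : Finset (Policy S A)) where
  next : (j : ℕ) → Kernel (Fin j → Record S A) (Policy S A)
  markov : ∀ j, IsMarkovKernel (next j)
  mem_hull : ∀ j h, ∀ᵐ p ∂(next j h), p ∈ Bandit.hull Pi

/-- For `n` iterations, the policies `π j` are chosen by the online algorithm from the records of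
the iterations before: given the past, `π j` has the law prescribed by the algorithm. -/
def OnlineAlg.Runs {Ω : Type w} [MeasurableSpace Ω] {Pi : Finset (Policy S A)}
    (alg : OnlineAlg Pi) (n : ℕ) (μ : Measure Ω) (ℋ : ℕ → MeasurableSpace Ω)
    (π : ℕ → Ω → Policy S A) (x : ℕ → Ω → Outcome S A) : Prop :=
  ∀ j < n, ∀ B : Set (Policy S A), MeasurableSet B →
    μ⟦π j ⁻¹' B | ℋ j⟧ =ᵐ[μ]
      fun ω => (alg.next j (fun l : Fin j => (x l ω, π l ω))).real B

/-- The no-regret guarantee for `n` iterations: whenever the algorithm interacts with the bandit,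
with probability at least `1 - δ`, for all `t ≤ n` the regret of its first `t` policies is at most
`C_OL R e^{2R} √(𝒞 t log^{c₀}(|Π| n / δ))`. -/
def OnlineAlg.NoRegret {Pi : Finset (Policy S A)} (alg : OnlineAlg Pi) (M : Bandit S A)
    (COL c₀ 𝒞 δ : ℝ) (n : ℕ) : Prop :=
  ∀ (Ω : Type w) [MeasurableSpace Ω] (μ : Measure Ω) [IsProbabilityMeasure μ]
    (ℋ 𝒢 : ℕ → MeasurableSpace Ω) (π : ℕ → Ω → Policy S A) (x : ℕ → Ω → Outcome S A),
    IsInteraction M n μ ℋ 𝒢 π x → alg.Runs n μ ℋ π x →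
    1 - δ ≤ μ.real {ω | ∀ t : ℕ, 1 ≤ t → t ≤ n →
      ∑ i ∈ Finset.range t, M.gap (π i ω) ≤
        COL * M.R * Real.exp (2 * M.R) *
          Real.sqrt (𝒞 * t * Real.log ((Pi.card : ℝ) * (n : ℝ) / δ) ^ c₀)}

/-- `π`, `x` are the policies and comparisons of a run of TPO: at the online iterations the policies
are computed by the online algorithm from the records of the earlier online iterations only, and at
the transfer iterations by transfer policy selection from all the earlier records. -/
structure IsTPORun {Ω : Type w} [MeasurableSpace Ω] (M : Bandit S A) (P : Config S A)
    (alg : OnlineAlg P.Pi) (μ : Measure Ω) (ℋ 𝒢 : ℕ → MeasurableSpace Ω)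
    (π : ℕ → Ω → Policy S A) (x : ℕ → Ω → Outcome S A) : Prop where
  interaction : IsInteraction M P.T μ ℋ 𝒢 π x
  online : alg.Runs (P.K * P.m) μ (fun j => ℋ (P.onlineTime j))
    (fun j => π (P.onlineTime j)) (fun j => x (P.onlineTime j))
  transfer : ∀ i < P.T, P.m ≤ i % P.N →
    ∀ᵐ ω ∂μ, P.IsTPS M (fun j => x j ω) (fun j => π j ω) i (π i ω)

end Interaction

section Bounds

variable {S : Type u} {A : Type v} [Fintype S] [Fintype A]

namespace Config

/-- The bound `C R e^{2R} √(α 𝒞 t log^{c₀}(|Π|T/δ))` on the online part of the regret. -/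
def regOL (P : Config S A) (M : Bandit S A) (C c₀ 𝒞 : ℝ) (t : ℕ) : ℝ :=
  C * (M.R * Real.exp (2 * M.R) * Real.sqrt (P.α * 𝒞 * t * P.logT ^ c₀))

/-- `ι = C R e^{2R} (Cov^{π*_{r*} | π_mix} ∧ √𝒞 / α) √(log^{c₀}(|Π|T/δ) / d)`, where `π_mix` is the
uniform mixture of the first `d` policies. -/
def iota (P : Config S A) (M : Bandit S A) (C c₀ 𝒞 : ℝ) (π : ℕ → Policy S A) (d : ℕ) : ℝ :=
  C * (M.R * Real.exp (2 * M.R) * min (M.cov (M.optPolicy M.rstar) (mix π d)) (Real.sqrt 𝒞 / P.α)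
    * Real.sqrt (1 / (d : ℝ) * P.logT ^ c₀))

open Classical in
/-- The cost of exploring the source rewards:
`e^{2R} √((1-α) W t log(|Π|WT/δ)) ∧ ∑_{w : Δ(w) > 0} e^{4R}/Δ(w) log(|Π|WT/δ)`. -/
def explore (P : Config S A) (M : Bandit S A) (t : ℕ) : ℝ :=
  min (Real.exp (2 * M.R) * Real.sqrt ((1 - P.α) * P.W * t * P.logWT))
    (∑ i ∈ Finset.univ.filter (fun i : Fin P.W => 0 < P.Δ M i),
      Real.exp (4 * M.R) / P.Δ M i * P.logWT)

end Config

end Bounds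

end

end RLHF

/-!
The proof rests on two events, each of probability at least `1 - δ`. On the first one, the online
iterations of the run satisfy the no-regret bound: taken by themselves they are an interaction of
the online learner with the bandit (`IsInteraction.online`). On the second one, the log-likelihood
concentrates: up to `2 log (|Π| T / δ)`, a reward `r` of the class is less likely than `r*` by
`κ²` times the sum of its mean squared preference errors `G_r(πⁱ)` along the run, where `κ` is the
least slope of the logistic function on `[-R, R]`. This is Markov's inequality for the exponential
supermartingale `∏ᵢ √(p_r / p_{r*})(xⁱ) exp(κ² G_r(πⁱ) / 2)`, whose drift is controlled by the
Hellinger affinity of Bernoulli laws (`measure_exists_not_concentrated_le`).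

On these events everything is deterministic (`Config.GoodRun`). The estimates of the sources are
optimistic and exceed the values by at most two bonuses (`abs_relValue_mle_sub_le`). The estimate of
the distilled policy is pessimistic (`estDstl_le`), and it competes with any `π'` in the hull: the
preference error of the minimizing reward under `π'` is at most the root of a coverage factor `B`
times its squared error along the data, and AM-GM absorbs the latter into the likelihood
(`relValue_sub_estDstl_le`). With `π' = π*_{r*}` the factor is the coverage coefficient. With `π'`
the mixture of the online policies it is `1/α`, and the no-regret bound makes `π'` nearly optimal.
Together they give `ι`. Including the policy of the current step in the mixture is harmless, as one
more record changes the mean squared error by at most `4 R² / d`.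

Hence a transfer step loses at most `Δ_min ∧ ι`, plus a bonus `b / √(N(w) + 1)` if it plays a source
`w` (`IsTPS.gap_le`). The visit counts at the steps that select `w` are distinct, so the bonuses
sum to `O(b √n)` per source, whence the minimax bound by Cauchy-Schwarz (`sum_le_add_sqrt`); and
a bonus of at least `Δ(w)/2` occurs at most `4 b² / Δ(w)²` times, whence the gap-dependent bound
(`sum_le_add_inv_gap`).
-/

/-! ### Bernoulli laws and the logistic function -/

namespace RLHF

/-- The squared Hellinger distance of two Bernoulli laws dominates the squared difference of their
parameters; here in terms of the affinity `√(pq) + √((1-p)(1-q))`. -/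
lemma bernoulli_affinity_le {p q : ℝ} (hp : p ∈ Set.Ioo (0 : ℝ) 1) (hq : q ∈ Set.Ioo (0 : ℝ) 1) :
    √(p * q) + √((1 - p) * (1 - q)) ≤ 1 - (p - q) ^ 2 / 2 := by
  obtain ⟨hp0, hp1⟩ := hp
  obtain ⟨hq0, hq1⟩ := hq
  have hd : (p - q) ^ 2 ≤ 1 := by nlinarith
  -- With `s = p + q` and `e = p - q`, the square of the affinity is at most `1 - e²`.
  set a := √(p * q) with ha
  set b := √((1 - p) * (1 - q)) with hb
  have ha2 : a ^ 2 = p * q := Real.sq_sqrt (by positivity)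
  have hb2 : b ^ 2 = (1 - p) * (1 - q) :=
    Real.sq_sqrt (mul_nonneg (by linarith) (by linarith))
  have ha0 : 0 ≤ a := Real.sqrt_nonneg _
  have hb0 : 0 ≤ b := Real.sqrt_nonneg _
  have hab : 2 * (a * b) ≤ p * (1 - p) + q * (1 - q) := by
    have h1 : (a * b) ^ 2 = (p * (1 - p)) * (q * (1 - q)) := by
      rw [mul_pow, ha2, hb2]; ring
    have hx : 0 ≤ p * (1 - p) := mul_nonneg hp0.le (by linarith)
    have hy : 0 ≤ q * (1 - q) := mul_nonneg hq0.le (by linarith)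
    have h0 : 0 ≤ a * b := by positivity
    refine abs_le_of_sq_le_sq' ?_ (by linarith) |>.2
    nlinarith [sq_nonneg (p * (1 - p) - q * (1 - q))]
  have hsq : (a + b) ^ 2 ≤ 1 - (p - q) ^ 2 := by
    have : (a + b) ^ 2 = a ^ 2 + b ^ 2 + 2 * (a * b) := by ring
    rw [this, ha2, hb2]
    nlinarith
  nlinarith [sq_nonneg (1 - (a + b))]

/-- The least slope of the logistic function on `[-R, R]`. -/
noncomputable def minSlope (R : ℝ) : ℝ := Real.exp R / (1 + Real.exp R) ^ 2

lemma minSlope_pos (R : ℝ) : 0 < minSlope R := by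
  unfold minSlope; positivity

lemma minSlope_eq (R : ℝ) : minSlope R = Real.sigmoid R * (1 - Real.sigmoid R) := by
  have : Real.sigmoid R = Real.exp R / (1 + Real.exp R) := by
    rw [Real.sigmoid_def, Real.exp_neg]
    field_simp
    ring
  rw [this, minSlope]
  field_simp
  ring

lemma minSlope_mul_abs_sub_le {R x y : ℝ} (hx : |x| ≤ R) (hy : |y| ≤ R) :
    minSlope R * |x - y| ≤ |Real.sigmoid x - Real.sigmoid y| := by
  wlog hxy : y ≤ x generalizing x y
  · rw [abs_sub_comm x y, abs_sub_comm (Real.sigmoid x)]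
    exact this hy hx (le_of_not_ge hxy)
  have hder : ∀ z ∈ interior (Set.Icc (-R) R), minSlope R ≤ deriv Real.sigmoid z := by
    intro z hz
    have hz := interior_subset hz
    rw [Real.deriv_sigmoid, minSlope_eq]
    have h1 : Real.sigmoid z ≤ Real.sigmoid R := Real.sigmoid_le hz.2
    have h2 : 1 - Real.sigmoid R ≤ Real.sigmoid z := by
      rw [← Real.sigmoid_neg]; exact Real.sigmoid_le hz.1
    change _ ≤ Real.sigmoid z * (1 - Real.sigmoid z)
    nlinarith
  have h := (convex_Icc (-R) R).mul_sub_le_image_sub_of_le_deriv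
    differentiable_sigmoid.continuous.continuousOn
    differentiable_sigmoid.differentiableOn hder y (abs_le.1 hy) x (abs_le.1 hx) hxy
  rw [abs_of_nonneg (sub_nonneg.2 hxy), abs_of_nonneg (sub_nonneg.2 (Real.sigmoid_le hxy))]
  exact h

/-! ### Preference errors and coverage -/

namespace Bandit

variable {S : Type u} {A : Type v} [Fintype S] [Fintype A] (M : Bandit S A)

/-- The expectation of `f s a ã` under `s ∼ ρ`, `a ∼ π(·|s)`, `ã ∼ πref(·|s)`. -/
noncomputable def pairExp (π : Policy S A) (f : S → A → A → ℝ) : ℝ :=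
  ∑ s, M.ρ s * ∑ a, π s a * ∑ a', M.πref s a' * f s a a'

/-- The error of the reward difference `r(s,a) - r(s,ã)`, which is all that comparisons can see. -/
def prefErr (r : Reward S A) (s : S) (a a' : A) : ℝ :=
  (r s a - r s a') - (M.rstar s a - M.rstar s a')

/-- The mean squared preference error of `r` on comparisons collected with `π`. -/
noncomputable def sqErr (r : Reward S A) (π : Policy S A) : ℝ :=
  M.pairExp π fun s a a' => M.prefErr r s a a' ^ 2

/-- The regularized value of `π` under `r`, relative to the reward of the reference policy. Only
this difference is determined by reward differences, hence by comparisons. -/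
noncomputable def relValue (r : Reward S A) (π : Policy S A) : ℝ :=
  M.expReward r π - M.expReward r M.πref - M.β * M.kl π

/-- A policy with full support. -/
def IsPosPolicy (π : Policy S A) : Prop := IsPolicy π ∧ ∀ s a, 0 < π s a

lemma pairExp_mono {π : Policy S A} (hπ : IsPolicy π) {f g : S → A → A → ℝ}
    (h : ∀ s a a', f s a a' ≤ g s a a') : M.pairExp π f ≤ M.pairExp π g :=
  Finset.sum_le_sum fun s _ => mul_le_mul_of_nonneg_left
    (Finset.sum_le_sum fun a _ => mul_le_mul_of_nonneg_left
      (Finset.sum_le_sum fun a' _ => mul_le_mul_of_nonneg_left (h s a a') (M.πref_pos s a').le)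
      (hπ.1 s a)) (M.ρ_nonneg s)

lemma pairExp_const {π : Policy S A} (hπ : IsPolicy π) (b : ℝ) :
    M.pairExp π (fun _ _ _ => b) = b := by
  simp [pairExp, ← Finset.sum_mul, M.πref_sum, hπ.2, M.ρ_sum]

lemma pairExp_eq_sum (π : Policy S A) (f : S → A → A → ℝ) :
    M.pairExp π f = ∑ z : S × A × A, M.ρ z.1 * (π z.1 z.2.1 * (M.πref z.1 z.2.2
      * f z.1 z.2.1 z.2.2)) := by
  simp only [pairExp, Finset.mul_sum, Fintype.sum_prod_type]

lemma pairExp_sum_policy {ι : Type*} (F : Finset ι) (b : ℝ) (π : ι → Policy S A)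
    (f : S → A → A → ℝ) :
    M.pairExp (fun s a => b * ∑ i ∈ F, π i s a) f = b * ∑ i ∈ F, M.pairExp (π i) f := by
  simp only [pairExp_eq_sum, Finset.mul_sum, Finset.sum_mul]
  rw [Finset.sum_comm]
  refine Finset.sum_congr rfl fun i _ => Finset.sum_congr rfl fun z _ => ?_
  ring

/-- Change of measure by the Cauchy-Schwarz inequality: the price is the coverage coefficient. -/
lemma pairExp_sq_le (π q : Policy S A) (hπ : IsPolicy π) (hq : ∀ s a, 0 < q s a)
    (f : S → A → A → ℝ) :
    M.pairExp π f ^ 2 ≤ M.cov π q * M.pairExp q (fun s a a' => f s a a' ^ 2) := by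
  have hcov : M.cov π q = M.pairExp π (fun s a _ => π s a / q s a) := by
    simp only [cov, pairExp, ← Finset.sum_mul, M.πref_sum, one_mul]
  rw [hcov]
  simp only [pairExp_eq_sum]
  refine Finset.sum_sq_le_sum_mul_sum_of_sq_le_mul _ (fun z _ => ?_) (fun z _ => ?_) fun z _ => ?_
  · exact mul_nonneg (M.ρ_nonneg _) (mul_nonneg (hπ.1 _ _) (mul_nonneg (M.πref_pos _ _).le
      (div_nonneg (hπ.1 _ _) (hq _ _).le)))
  · exact mul_nonneg (M.ρ_nonneg _) (mul_nonneg (hq _ _).le (mul_nonneg (M.πref_pos _ _).le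
      (sq_nonneg _)))
  · have := (hq z.1 z.2.1).ne'
    exact le_of_eq (by field_simp)

lemma cov_self {π : Policy S A} (hπ : IsPosPolicy π) : M.cov π π = 1 := by
  have h : ∀ s a, π s a * (π s a / π s a) = π s a := fun s a => by
    rw [div_self (hπ.2 s a).ne', mul_one]
  simp [cov, h, hπ.1.2, M.ρ_sum]

lemma one_le_cov {π q : Policy S A} (hπ : IsPolicy π) (hq : IsPosPolicy q) :
    1 ≤ M.cov π q := by
  have h := M.pairExp_sq_le π q hπ hq.2 (fun _ _ _ => 1)
  simpa [M.pairExp_const hπ, M.pairExp_const hq.1] using h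

lemma relValue_sub_relValue_rstar {π : Policy S A} (hπ : IsPolicy π) (r : Reward S A) :
    M.relValue r π - M.relValue M.rstar π = M.pairExp π (M.prefErr r) := by
  have h : ∀ (r : Reward S A) (s : S),
      ∑ a, π s a * ∑ a', M.πref s a' * (r s a - r s a')
        = ∑ a, π s a * r s a - ∑ a, M.πref s a * r s a := by
    intro r s
    simp only [mul_sub, Finset.sum_sub_distrib, ← Finset.sum_mul, M.πref_sum, one_mul, hπ.2]
  have h2 : ∀ r : Reward S A, M.pairExp π (fun s a a' => r s a - r s a')
      = M.expReward r π - M.expReward r M.πref := by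
    intro r
    simp only [pairExp, h]
    simp only [mul_sub, Finset.sum_sub_distrib, expReward]
  have h3 : M.pairExp π (M.prefErr r) = M.pairExp π (fun s a a' => r s a - r s a')
      - M.pairExp π (fun s a a' => M.rstar s a - M.rstar s a') := by
    simp only [pairExp_eq_sum, ← Finset.sum_sub_distrib, prefErr]
    refine Finset.sum_congr rfl fun z _ => ?_
    ring
  rw [h3, h2, h2, relValue, relValue]
  ring

lemma abs_sub_le_of_mem_Icc {R x y : ℝ} (hx : x ∈ Set.Icc 0 R) (hy : y ∈ Set.Icc 0 R) :
    |x - y| ≤ R :=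
  abs_le.2 ⟨by linarith [hx.1, hy.2], by linarith [hx.2, hy.1]⟩

lemma sqErr_nonneg (r : Reward S A) {π : Policy S A} (hπ : IsPolicy π) : 0 ≤ M.sqErr r π := by
  rw [← M.pairExp_const hπ 0]
  exact M.pairExp_mono hπ fun s a a' => sq_nonneg _

lemma sqErr_le {r : Reward S A} (hr : ∀ s a, r s a ∈ Set.Icc 0 M.R) {π : Policy S A}
    (hπ : IsPolicy π) : M.sqErr r π ≤ 4 * M.R ^ 2 := by
  rw [← M.pairExp_const hπ (4 * M.R ^ 2)]
  refine M.pairExp_mono hπ fun s a a' => ?_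
  have h1 := abs_le.1 (abs_sub_le_of_mem_Icc (hr s a) (hr s a'))
  have h2 := abs_le.1 (abs_sub_le_of_mem_Icc (M.rstar_mem s a) (M.rstar_mem s a'))
  have h3 : |M.prefErr r s a a'| ≤ 2 * M.R :=
    abs_le.2 ⟨by simp only [prefErr]; linarith [h1.1, h2.2],
      by simp only [prefErr]; linarith [h1.2, h2.1]⟩
  calc M.prefErr r s a a' ^ 2 = |M.prefErr r s a a'| ^ 2 := (sq_abs _).symm
    _ ≤ (2 * M.R) ^ 2 := pow_le_pow_left₀ (abs_nonneg _) h3 2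
    _ = 4 * M.R ^ 2 := by ring

/-! ### Optimal policies, value gaps, and the convex hull of the class -/

lemma nonempty_action {S : Type u} {A : Type v} [Fintype S] [Fintype A] (M : Bandit S A) (s : S) :
    Nonempty A := by
  by_contra h
  rw [not_nonempty_iff] at h
  simpa using M.πref_sum s

lemma partition_pos (r : Reward S A) (s : S) :
    0 < ∑ b, M.πref s b * Real.exp (r s b / M.β) := by
  have := M.nonempty_action s
  exact Finset.sum_pos (fun b _ => mul_pos (M.πref_pos s b) (Real.exp_pos _))
    Finset.univ_nonempty

lemma isPosPolicy_optPolicy (r : Reward S A) : IsPosPolicy (M.optPolicy r) :=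
  ⟨(M.isMaxOn_optPolicy r).1, fun s a =>
    div_pos (mul_pos (M.πref_pos s a) (Real.exp_pos _)) (M.partition_pos r s)⟩

lemma gap_nonneg {π : Policy S A} (hπ : IsPolicy π) : 0 ≤ M.gap π :=
  sub_nonneg.2 ((M.isMaxOn_optPolicy M.rstar).2 hπ)

lemma gap_eq_relValue (π : Policy S A) :
    M.gap π = M.relValue M.rstar (M.optPolicy M.rstar) - M.relValue M.rstar π := by
  simp only [gap, J, value, relValue]
  ring

lemma expReward_mem_Icc {r : Reward S A} (hr : ∀ s a, r s a ∈ Set.Icc 0 M.R) {π : Policy S A}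
    (hπ : IsPolicy π) : M.expReward r π ∈ Set.Icc 0 M.R := by
  constructor
  · exact Finset.sum_nonneg fun s _ => mul_nonneg (M.ρ_nonneg s)
      (Finset.sum_nonneg fun a _ => mul_nonneg (hπ.1 s a) (hr s a).1)
  · calc M.expReward r π ≤ ∑ s, M.ρ s * ∑ a, π s a * M.R :=
          Finset.sum_le_sum fun s _ => mul_le_mul_of_nonneg_left
            (Finset.sum_le_sum fun a _ => mul_le_mul_of_nonneg_left (hr s a).2 (hπ.1 s a))
            (M.ρ_nonneg s)
      _ = M.R := by simp [← Finset.sum_mul, hπ.2, M.ρ_sum]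

/-- Optimality of `π*_r` under `r` cancels the KL terms. -/
lemma gap_optPolicy_le {r : Reward S A} (hr : ∀ s a, r s a ∈ Set.Icc 0 M.R) :
    M.gap (M.optPolicy r) ≤ 2 * M.R := by
  have hs := (M.isPosPolicy_optPolicy M.rstar).1
  have hw := (M.isPosPolicy_optPolicy r).1
  have h : M.value r (M.optPolicy M.rstar) ≤ M.value r (M.optPolicy r) :=
    (M.isMaxOn_optPolicy r).2 hs
  have h1 := M.expReward_mem_Icc M.rstar_mem hs
  have h2 := M.expReward_mem_Icc hr hs
  have h3 := M.expReward_mem_Icc M.rstar_mem hw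
  have h4 := M.expReward_mem_Icc hr hw
  simp only [gap, J, value] at h ⊢
  linarith [h1.2, h2.1, h3.1, h4.2]

lemma IsPosPolicy.combination {S : Type u} {A : Type v} [Fintype A] {ι : Type*} {F : Finset ι}
    (w : ι → ℝ) (hw : ∀ i ∈ F, 0 < w i)
    (hw1 : ∑ i ∈ F, w i = 1) (π : ι → Policy S A) (hπ : ∀ i ∈ F, IsPosPolicy (π i)) :
    IsPosPolicy (fun s a => ∑ i ∈ F, w i * π i s a) := by
  have hF : F.Nonempty := by
    by_contra h
    rw [Finset.not_nonempty_iff_eq_empty] at h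
    simp [h] at hw1
  have h0 : ∀ s a, 0 < ∑ i ∈ F, w i * π i s a := fun s a =>
    Finset.sum_pos (fun i hi => mul_pos (hw i hi) ((hπ i hi).2 s a)) hF
  refine ⟨⟨fun s a => (h0 s a).le, fun s => ?_⟩, h0⟩
  rw [Finset.sum_comm]
  simp only [← Finset.mul_sum]
  rw [← hw1]
  exact Finset.sum_congr rfl fun i hi => by rw [(hπ i hi).1.2, mul_one]

lemma IsPosPolicy.average {S : Type u} {A : Type v} [Fintype A] {ι : Type*} {F : Finset ι}
    (hF : F.Nonempty) (π : ι → Policy S A) (hπ : ∀ i ∈ F, IsPosPolicy (π i)) :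
    IsPosPolicy (fun s a => 1 / (F.card : ℝ) * ∑ i ∈ F, π i s a) := by
  have hc : (0 : ℝ) < F.card := by exact_mod_cast hF.card_pos
  simp only [Finset.mul_sum]
  refine IsPosPolicy.combination _ (fun _ _ => by positivity) ?_ π hπ
  rw [Finset.sum_const, nsmul_eq_mul]
  field_simp

lemma average_mem_hull {S : Type u} {A : Type v} {ι : Type*} {F : Finset ι}
    (hF : F.Nonempty) {Pi : Finset (Policy S A)} (π : ι → Policy S A)
    (hπ : ∀ i ∈ F, π i ∈ hull Pi) :
    (fun s a => 1 / (F.card : ℝ) * ∑ i ∈ F, π i s a) ∈ hull Pi := by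
  have hc : (0 : ℝ) < F.card := by exact_mod_cast hF.card_pos
  have h := (convex_convexHull ℝ (Pi : Set (Policy S A))).sum_mem (t := F)
    (w := fun _ => 1 / (F.card : ℝ)) (z := π) (fun _ _ => by positivity)
    (by rw [Finset.sum_const, nsmul_eq_mul]; field_simp) hπ
  have he : (fun s a => 1 / (F.card : ℝ) * ∑ i ∈ F, π i s a)
      = ∑ i ∈ F, (1 / (F.card : ℝ)) • π i := by
    funext s a
    simp [Finset.sum_apply, Finset.mul_sum]
  rw [he]
  exact h

lemma GoodClass.isPosPolicy_of_mem_hull {Pi : Finset (Policy S A)} {M : Bandit S A}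
    (h : M.GoodClass Pi) {π : Policy S A} (hπ : π ∈ hull Pi) : IsPosPolicy π := by
  have hconv : Convex ℝ {π : Policy S A | IsPosPolicy π} := by
    intro π₁ h₁ π₂ h₂ a b ha hb hab
    have hpos : ∀ s c, 0 < a * π₁ s c + b * π₂ s c := by
      intro s c
      have h1 := h₁.2 s c
      have h2 := h₂.2 s c
      rcases ha.eq_or_lt with h0 | h0
      · have : b = 1 := by linarith
        rw [← h0, this]; linarith
      · have := mul_pos h0 h1
        have := mul_nonneg hb h2.le
        linarith
    refine ⟨⟨fun s c => (hpos s c).le, fun s => ?_⟩, hpos⟩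
    simp [Finset.sum_add_distrib, ← Finset.mul_sum, h₁.1.2, h₂.1.2, hab]
  have hsub : (Pi : Set (Policy S A)) ⊆ {π : Policy S A | IsPosPolicy π} :=
    fun π hπ => ⟨h.isPolicy π hπ, fun s a => (h.ratio π hπ s a).1⟩
  exact convexHull_min hsub hconv hπ

/-- Averaging policies does not increase the value gap, since `KL(· ‖ πref)` is convex. -/
lemma gap_average_le {ι : Type*} {F : Finset ι} (hF : F.Nonempty) (π : ι → Policy S A)
    (hπ : ∀ i ∈ F, IsPolicy (π i)) :
    M.gap (fun s a => 1 / (F.card : ℝ) * ∑ i ∈ F, π i s a)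
      ≤ 1 / (F.card : ℝ) * ∑ i ∈ F, M.gap (π i) := by
  have hc : (0 : ℝ) < F.card := by exact_mod_cast hF.card_pos
  have hw1 : ∑ _i ∈ F, 1 / (F.card : ℝ) = 1 := by
    rw [Finset.sum_const, nsmul_eq_mul]; field_simp
  set w : ℝ := 1 / (F.card : ℝ) with hw
  have hw0 : 0 ≤ w := by positivity
  have hval : ∀ π : Policy S A, M.J π = ∑ s, M.ρ s * ∑ a,
      (π s a * (M.rstar s a + M.β * Real.log (M.πref s a))
        - M.β * (π s a * Real.log (π s a))) := by
    intro π
    simp only [J, value, expReward, kl, Finset.mul_sum, ← Finset.sum_sub_distrib]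
    refine Finset.sum_congr rfl fun s _ => Finset.sum_congr rfl fun a _ => ?_
    by_cases h : π s a = 0
    · simp [h]
    · rw [Real.log_div h (M.πref_pos s a).ne']
      ring
  have hJ : w * ∑ i ∈ F, M.J (π i) ≤ M.J (fun s a => w * ∑ i ∈ F, π i s a) := by
    have hswap : w * ∑ i ∈ F, M.J (π i) = ∑ s, M.ρ s * ∑ a, w * ∑ i ∈ F,
        (π i s a * (M.rstar s a + M.β * Real.log (M.πref s a))
          - M.β * (π i s a * Real.log (π i s a))) := by
      simp only [hval, Finset.mul_sum]
      rw [Finset.sum_comm]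
      refine Finset.sum_congr rfl fun s _ => ?_
      rw [Finset.sum_comm]
      refine Finset.sum_congr rfl fun a _ => Finset.sum_congr rfl fun i _ => ?_
      ring
    rw [hswap, hval]
    refine Finset.sum_le_sum fun s _ => mul_le_mul_of_nonneg_left
      (Finset.sum_le_sum fun a _ => ?_) (M.ρ_nonneg s)
    have hj := Real.convexOn_mul_log.map_sum_le (t := F) (w := fun _ => w)
      (p := fun i => π i s a) (fun _ _ => hw0) hw1 (fun i hi => (hπ i hi).1 s a)
    simp only [smul_eq_mul, ← Finset.mul_sum] at hj
    rw [Finset.sum_sub_distrib, ← Finset.sum_mul, ← Finset.mul_sum]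
    nlinarith [mul_le_mul_of_nonneg_left hj M.β_pos.le]
  simp only [gap, Finset.sum_sub_distrib, Finset.sum_const, nsmul_eq_mul]
  have : w * (F.card : ℝ) = 1 := by rw [hw]; field_simp
  have h2 : w * ((F.card : ℝ) * M.J (M.optPolicy M.rstar)) = M.J (M.optPolicy M.rstar) := by
    rw [← mul_assoc, this, one_mul]
  rw [mul_sub, h2]
  linarith

/-! ### The induced reward class -/

lemma rewardOf_mem_Icc (hR : 0 ≤ M.R) (π : Policy S A) (s : S) (a : A) :
    M.rewardOf π s a ∈ Set.Icc 0 M.R :=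
  ⟨le_max_left _ _, max_le hR (min_le_left _ _)⟩

lemma mem_Icc_of_mem_rewardClass (hR : 0 ≤ M.R) {Pi : Finset (Policy S A)} {r : Reward S A}
    (hr : r ∈ M.rewardClass Pi) (s : S) (a : A) : r s a ∈ Set.Icc 0 M.R := by
  obtain ⟨π, -, rfl⟩ := hr
  exact M.rewardOf_mem_Icc hR π s a

/-- The reward of the optimal policy is `r*` up to a shift that depends on the state only, and such
a shift changes neither the law of the labels nor relative values. -/
lemma rewardOf_optPolicy_rstar (s : S) (a : A) :
    M.rewardOf (M.optPolicy M.rstar) s a = M.rstar s a - ⨅ a', M.rstar s a' := by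
  have := M.nonempty_action s
  have hlog : ∀ a, M.β * Real.log (M.optPolicy M.rstar s a / M.πref s a)
      = M.rstar s a - M.β * Real.log (∑ b, M.πref s b * Real.exp (M.rstar s b / M.β)) := by
    intro a
    have h1 : M.optPolicy M.rstar s a / M.πref s a
        = Real.exp (M.rstar s a / M.β) / ∑ b, M.πref s b * Real.exp (M.rstar s b / M.β) := by
      have := (M.πref_pos s a).ne'
      simp only [optPolicy]
      field_simp
    have hβ := M.β_pos.ne'
    rw [h1, Real.log_div (Real.exp_pos _).ne' (M.partition_pos _ s).ne', Real.log_exp]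
    field_simp
  have hbdd : BddBelow (Set.range fun a' => M.rstar s a') := Set.finite_range _ |>.bddBelow
  have hinf : ⨅ a', (M.rstar s a'
        - M.β * Real.log (∑ b, M.πref s b * Real.exp (M.rstar s b / M.β)))
      = (⨅ a', M.rstar s a') - M.β * Real.log (∑ b, M.πref s b * Real.exp (M.rstar s b / M.β)) :=
    (ciInf_sub hbdd _).symm
  have h0 : ⨅ a', M.rstar s a' ≤ M.rstar s a := ciInf_le hbdd a
  have h1 : 0 ≤ ⨅ a', M.rstar s a' := le_ciInf fun a' => (M.rstar_mem s a').1
  simp only [rewardOf, hlog]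
  rw [hinf, sub_sub_sub_cancel_right, min_eq_right (by linarith [(M.rstar_mem s a).2]),
    max_eq_right (by linarith)]

lemma btProb_rewardOf_optPolicy_rstar (z : Outcome S A) :
    btProb (M.rewardOf (M.optPolicy M.rstar)) z = btProb M.rstar z := by
  obtain ⟨s, a, a', y⟩ := z
  cases y <;> simp only [btProb, rewardOf_optPolicy_rstar, sub_sub_sub_cancel_right]

lemma nll_rewardOf_optPolicy_rstar (x : ℕ → Outcome S A) (d : ℕ) :
    nll x d (M.rewardOf (M.optPolicy M.rstar)) = nll x d M.rstar := by
  simp only [nll, btProb_rewardOf_optPolicy_rstar]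

lemma relValue_rewardOf_optPolicy_rstar {π : Policy S A} (hπ : IsPolicy π) :
    M.relValue (M.rewardOf (M.optPolicy M.rstar)) π = M.relValue M.rstar π := by
  have h := M.relValue_sub_relValue_rstar hπ (M.rewardOf (M.optPolicy M.rstar))
  have h0 : M.prefErr (M.rewardOf (M.optPolicy M.rstar)) = fun _ _ _ => 0 := by
    funext s a a'
    simp only [prefErr, rewardOf_optPolicy_rstar]
    ring
  rw [h0, M.pairExp_const hπ] at h
  linarith

lemma GoodClass.rewardOf_optPolicy_mem {Pi : Finset (Policy S A)} {M : Bandit S A}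
    (h : M.GoodClass Pi) : M.rewardOf (M.optPolicy M.rstar) ∈ M.rewardClass Pi :=
  ⟨_, h.realizable, rfl⟩

/-! ### The affinity of two preference models -/

lemma btProb_pos {S : Type u} {A : Type v} (r : Reward S A) (z : Outcome S A) : 0 < btProb r z := by
  obtain ⟨s, a, a', y⟩ := z
  cases y <;> exact Real.sigmoid_pos _

/-- Under comparisons collected with `π`, the mean of the root likelihood ratio of `r` against `r*`
falls below one by a multiple of the squared preference error of `r`. -/
lemma sum_sqrt_ratio_mul_outcomeProb_le {r : Reward S A} (hr : ∀ s a, r s a ∈ Set.Icc 0 M.R)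
    {π : Policy S A} (hπ : IsPolicy π) :
    ∑ z, √(btProb r z / btProb M.rstar z) * M.outcomeProb π z
      ≤ 1 - minSlope M.R ^ 2 / 2 * M.sqErr r π := by
  have hsum : ∑ z, √(btProb r z / btProb M.rstar z) * M.outcomeProb π z
      = M.pairExp π (fun s a a' => √(btProb r (s, a, a', true) * btProb M.rstar (s, a, a', true))
          + √(btProb r (s, a, a', false) * btProb M.rstar (s, a, a', false))) := by
    simp only [pairExp, Fintype.sum_prod_type, Fintype.sum_bool, Finset.mul_sum]
    refine Finset.sum_congr rfl fun s _ => Finset.sum_congr rfl fun a _ =>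
      Finset.sum_congr rfl fun a' _ => ?_
    have key : ∀ z : Outcome S A, √(btProb r z / btProb M.rstar z) * btProb M.rstar z
        = √(btProb r z * btProb M.rstar z) := by
      intro z
      have h0 := btProb_pos M.rstar z
      rw [Real.sqrt_div' _ h0.le, Real.sqrt_mul' _ h0.le, div_mul_eq_mul_div, mul_div_assoc,
        Real.div_sqrt]
    simp only [outcomeProb]
    rw [← key, ← key]
    ring
  have hrhs : 1 - minSlope M.R ^ 2 / 2 * M.sqErr r π
      = M.pairExp π (fun s a a' => 1 - minSlope M.R ^ 2 / 2 * M.prefErr r s a a' ^ 2) := by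
    have h1 := M.pairExp_const hπ 1
    rw [sqErr]
    nth_rewrite 1 [← h1]
    simp only [pairExp_eq_sum, Finset.mul_sum, ← Finset.sum_sub_distrib]
    refine Finset.sum_congr rfl fun z _ => ?_
    ring
  rw [hsum, hrhs]
  refine M.pairExp_mono hπ fun s a a' => ?_
  have hx := abs_sub_le_of_mem_Icc (hr s a) (hr s a')
  have hy := abs_sub_le_of_mem_Icc (M.rstar_mem s a) (M.rstar_mem s a')
  have hslope := minSlope_mul_abs_sub_le hx hy
  have haff := bernoulli_affinity_le
    ⟨Real.sigmoid_pos (r s a - r s a'), Real.sigmoid_lt_one _⟩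
    ⟨Real.sigmoid_pos (M.rstar s a - M.rstar s a'), Real.sigmoid_lt_one _⟩
  have hneg : ∀ r : Reward S A, btProb r (s, a, a', false)
      = 1 - Real.sigmoid (r s a - r s a') := by
    intro r
    rw [← Real.sigmoid_neg, neg_sub]
    rfl
  have hsq : (minSlope M.R * |(r s a - r s a') - (M.rstar s a - M.rstar s a')|) ^ 2
      ≤ |Real.sigmoid (r s a - r s a') - Real.sigmoid (M.rstar s a - M.rstar s a')| ^ 2 :=
    pow_le_pow_left₀ (mul_nonneg (minSlope_pos _).le (abs_nonneg _)) hslope 2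
  rw [mul_pow, sq_abs, sq_abs] at hsq
  rw [hneg, hneg]
  simp only [btProb, prefErr]
  linarith

end Bandit

/-! ### Guarantees for the value estimates on the concentration event -/

namespace Config

variable {S : Type u} {A : Type v} [Fintype S] [Fintype A] (P : Config S A) (M : Bandit S A)

/-- The maximum likelihood event on the first `d` records: every reward of the class whose
preference error along the data is large has a correspondingly larger negative log-likelihood
than `r*`. -/
def Concentrated (x : ℕ → Outcome S A) (π : ℕ → Policy S A) (d : ℕ) : Prop :=
  ∀ r ∈ M.rewardClass P.Pi,
    d * (nll x d M.rstar - nll x d r) + minSlope M.R ^ 2 * ∑ i ∈ Finset.range d, M.sqErr r (π i)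
      ≤ 2 * P.logT

variable {P M} {x : ℕ → Outcome S A} {π : ℕ → Policy S A} {d : ℕ}

lemma half_le_log {y : ℝ} (hy : 2 ≤ y) : 1 / 2 ≤ Real.log y := by
  have := Real.log_two_gt_d9
  have := Real.log_le_log (by norm_num) hy
  linarith

lemma two_le_card_mul_div {n m : ℕ} {δ : ℝ} (hn : 1 ≤ n) (hm : 2 ≤ m) (h0 : 0 < δ) (h1 : δ < 1) :
    2 ≤ (n : ℝ) * m / δ := by
  rw [le_div_iff₀ h0]
  have h2 : (2 : ℝ) ≤ n * m := by exact_mod_cast Nat.mul_le_mul hn hm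
  nlinarith

lemma half_le_logT {S : Type u} {A : Type v} {P : Config S A} (hPi : P.Pi.Nonempty)
    (hT : 2 ≤ P.T) (h0 : 0 < P.δ) (h1 : P.δ < 1) :
    1 / 2 ≤ P.logT :=
  half_le_log (two_le_card_mul_div hPi.card_pos hT h0 h1)

lemma logT_le_logWT {S : Type u} {A : Type v} {P : Config S A} (hPi : P.Pi.Nonempty)
    (hT : 2 ≤ P.T) (h0 : 0 < P.δ) (h1 : P.δ < 1)
    (hW : 1 ≤ P.W) : P.logT ≤ P.logWT := by
  have h2 := two_le_card_mul_div hPi.card_pos hT h0 h1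
  refine Real.log_le_log (by linarith) (div_le_div_of_nonneg_right ?_ h0.le)
  have hW' : (1 : ℝ) ≤ P.W := by exact_mod_cast hW
  have : (0 : ℝ) ≤ (P.Pi.card : ℝ) * P.T := by positivity
  nlinarith

lemma eta_pos (hc : 2 ≤ P.c) (hd : 1 ≤ d) (hl : 1 / 2 ≤ P.logT) : 0 < P.eta M d := by
  have hd' : (0 : ℝ) < d := by exact_mod_cast hd
  have hl' : 0 < P.logT := by linarith
  have : 0 < P.c := by linarith
  unfold eta
  positivity

lemma rpoObj_eq (r : Reward S A) (p : Policy S A) :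
    P.rpoObj M x d p r = nll x d r + P.eta M d * M.relValue r p := rfl

lemma estDstl_eq (rmle : Reward S A) (πD : Policy S A) (rD : Reward S A)
    (hη : 0 < P.eta M d) :
    P.estDstl M x d rmle πD rD = 1 / P.eta M d * (P.rpoObj M x d πD rD - nll x d rmle)
      - 2 * P.c * Real.exp (2 * M.R) * √(1 / (d : ℝ) * P.logT) := by
  rw [rpoObj_eq]
  simp only [estDstl, Bandit.relValue]
  field_simp
  ring

/-- The maximum likelihood event, divided by the number of records. -/
lemma Concentrated.nll_sub_le (h : P.Concentrated M x π d) (hd : 1 ≤ d) (hl : 0 ≤ P.logT)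
    {r : Reward S A} (hr : r ∈ M.rewardClass P.Pi) :
    nll x d M.rstar - nll x d r
      + minSlope M.R ^ 2 * (1 / (d : ℝ) * ∑ i ∈ Finset.range d, M.sqErr r (π i))
      ≤ 2 * √(1 / (d : ℝ) * P.logT) ^ 2 := by
  have hd' : (0 : ℝ) < d := by exact_mod_cast hd
  have h1 := h r hr
  rw [Real.sq_sqrt (by positivity)]
  have h2 := mul_le_mul_of_nonneg_left h1 (by positivity : (0 : ℝ) ≤ 1 / d)
  have h3 : 1 / (d : ℝ) * (d * (nll x d M.rstar - nll x d r)
        + minSlope M.R ^ 2 * ∑ i ∈ Finset.range d, M.sqErr r (π i))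
      = nll x d M.rstar - nll x d r
      + minSlope M.R ^ 2 * (1 / (d : ℝ) * ∑ i ∈ Finset.range d, M.sqErr r (π i)) := by
    field_simp
  rw [h3] at h2
  linarith

/-- The estimate of the distilled policy is pessimistic. -/
lemma estDstl_le (hclass : M.GoodClass P.Pi) (hR : 1 ≤ M.R) (hc : 2 ≤ P.c) (hd : 1 ≤ d)
    (hl : 1 / 2 ≤ P.logT) (hπ : ∀ i < d, IsPolicy (π i)) (h : P.Concentrated M x π d)
    {rmle : Reward S A} {πD : Policy S A} {rD : Reward S A} (hmle : P.IsMLE M x d rmle)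
    (hrpo : P.IsRPO M x d πD rD) : P.estDstl M x d rmle πD rD ≤ M.relValue M.rstar πD := by
  have hη := eta_pos (M := M) hc hd hl
  have hd' : (0 : ℝ) < d := by exact_mod_cast hd
  have hD := (hclass.isPosPolicy_of_mem_hull hrpo.1).1
  have h1 := hrpo.2.2.1 _ hclass.rewardOf_optPolicy_mem
  have h2 := h.nll_sub_le hd (by linarith) hmle.1
  have hQ : 0 ≤ minSlope M.R ^ 2 * (1 / (d : ℝ) * ∑ i ∈ Finset.range d, M.sqErr rmle (π i)) := by
    have : 0 ≤ ∑ i ∈ Finset.range d, M.sqErr rmle (π i) :=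
      Finset.sum_nonneg fun i hi => M.sqErr_nonneg _ (hπ i (Finset.mem_range.1 hi))
    positivity
  rw [rpoObj_eq (M.rewardOf _), M.nll_rewardOf_optPolicy_rstar,
    M.relValue_rewardOf_optPolicy_rstar hD] at h1
  rw [estDstl_eq _ _ _ hη]
  set v := √(1 / (d : ℝ) * P.logT) with hv
  have hl0 : 0 < P.logT := by linarith
  have hv0 : 0 < v := Real.sqrt_pos.2 (by positivity)
  have h3 : 1 / P.eta M d * (P.rpoObj M x d πD rD - nll x d rmle)
      ≤ 1 / P.eta M d * (P.eta M d * M.relValue M.rstar πD + 2 * v ^ 2) :=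
    mul_le_mul_of_nonneg_left (by linarith) (by positivity)
  have h4 : 1 / P.eta M d * (P.eta M d * M.relValue M.rstar πD + 2 * v ^ 2)
      = M.relValue M.rstar πD + 2 * v ^ 2 / P.eta M d := by field_simp
  have h5 : 2 * v ^ 2 / P.eta M d ≤ 2 * P.c * Real.exp (2 * M.R) * v := by
    have hE : 1 ≤ Real.exp M.R := Real.one_le_exp (by linarith)
    have hE2 : Real.exp (2 * M.R) = Real.exp M.R ^ 2 := by rw [← Real.exp_nat_mul]; norm_cast
    have : 2 * v ^ 2 / P.eta M d = 2 * v * (1 + Real.exp M.R) ^ 2 / P.c := by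
      simp only [eta, ← hv]; field_simp
    rw [this, hE2, div_le_iff₀ (by linarith)]
    have h6 : (1 + Real.exp M.R) ^ 2 ≤ (P.c * Real.exp M.R) ^ 2 :=
      pow_le_pow_left₀ (by linarith) (by nlinarith) 2
    nlinarith [mul_le_mul_of_nonneg_left h6 hv0.le]
  linarith

/-- The total error of the pessimistic optimization for the step size `η`, with `E = e^R`. -/
lemma rpo_error_le {E R c B l d v η k : ℝ} (hE : 1 ≤ E) (hR : 1 ≤ R) (hRE : R ≤ E) (hc : 2 ≤ c)
    (hB : 1 ≤ B) (hl : 1 / 2 ≤ l) (hd : 0 < d) (hv0 : 0 < v) (hv2 : v ^ 2 = 1 / d * l)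
    (hη : η = c * ((1 + E) ^ 2)⁻¹ * v) (hk : k = (E / (1 + E) ^ 2) ^ 2) :
    B * η / (4 * k) + k * (4 * R ^ 2 / d) / η + 2 * v ^ 2 / η + 2 * c * E ^ 2 * v
      ≤ (3 * c + 8) * (R * E ^ 2 * B * v) := by
  have hc0 : 0 < c := by linarith
  have hEs : (1 + E) ^ 2 ≤ 4 * E ^ 2 := by nlinarith
  have t1 : η / (4 * k) ≤ c * v := by
    have : η / (4 * k) = c * v * ((1 + E) ^ 2 / (4 * E ^ 2)) := by
      rw [hk, hη]; field_simp
    rw [this]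
    exact mul_le_of_le_one_right (by positivity) ((div_le_one (by positivity)).2 hEs)
  have t2 : k * (4 * R ^ 2 / d) / η ≤ 4 * R ^ 2 * v := by
    have h1 : 1 / d ≤ 2 * v ^ 2 := by
      rw [hv2]
      have : 0 < 1 / d := by positivity
      nlinarith
    have h2 : k * (4 * R ^ 2 / d) / η
        = 4 * R ^ 2 * (E ^ 2 / (1 + E) ^ 2) * (1 / (c * v)) * (1 / d) := by
      rw [hk, hη]; field_simp
    have h3 : E ^ 2 / (1 + E) ^ 2 ≤ 1 := (div_le_one (by positivity)).2 (by nlinarith)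
    have h4 : E ^ 2 / (1 + E) ^ 2 * (1 / d) ≤ 1 * (2 * v ^ 2) :=
      mul_le_mul h3 h1 (by positivity) zero_le_one
    calc k * (4 * R ^ 2 / d) / η
        = 4 * R ^ 2 * (1 / (c * v)) * (E ^ 2 / (1 + E) ^ 2 * (1 / d)) := by rw [h2]; ring
      _ ≤ 4 * R ^ 2 * (1 / (c * v)) * (1 * (2 * v ^ 2)) :=
        mul_le_mul_of_nonneg_left h4 (by positivity)
      _ = 4 * R ^ 2 * v * (2 / c) := by field_simp
      _ ≤ 4 * R ^ 2 * v :=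
        mul_le_of_le_one_right (by positivity) ((div_le_one hc0).2 hc)
  have t3 : 2 * v ^ 2 / η ≤ 4 * E ^ 2 * v := by
    have : 2 * v ^ 2 / η = (1 + E) ^ 2 * v * (2 / c) := by
      rw [hη]; field_simp
    rw [this]
    calc (1 + E) ^ 2 * v * (2 / c) ≤ (1 + E) ^ 2 * v :=
          mul_le_of_le_one_right (by positivity) ((div_le_one hc0).2 hc)
      _ ≤ 4 * E ^ 2 * v := by gcongr
  have hBη : B * η / (4 * k) ≤ B * (c * v) := by
    rw [mul_div_assoc]
    exact mul_le_mul_of_nonneg_left t1 (by linarith)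
  have hR0 : 0 ≤ R := by linarith
  have e1 : B * (c * v) ≤ c * (R * E ^ 2 * B * v) := by
    have : 1 ≤ R * E ^ 2 := by nlinarith
    nlinarith [mul_le_mul_of_nonneg_right this (by positivity : 0 ≤ c * (B * v))]
  have e2 : 4 * R ^ 2 * v ≤ 4 * (R * E ^ 2 * B * v) := by
    have : R ^ 2 ≤ R * E ^ 2 * B := by
      have h1 : R * R ≤ R * E ^ 2 := mul_le_mul_of_nonneg_left (by nlinarith) hR0
      nlinarith [mul_le_mul_of_nonneg_left hB (by positivity : 0 ≤ R * E ^ 2)]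
    nlinarith
  have e3 : E ^ 2 * v ≤ R * E ^ 2 * B * v := by
    have : 1 ≤ R * B := by nlinarith
    nlinarith [mul_le_mul_of_nonneg_left this (by positivity : 0 ≤ E ^ 2 * v)]
  have e4 : 2 * c * E ^ 2 * v ≤ 2 * c * (R * E ^ 2 * B * v) := by
    nlinarith [mul_le_mul_of_nonneg_left e3 hc0.le]
  linarith

/-- The estimate of the distilled policy competes with every policy `π'` of the hull under which
squared preference errors are at most `B` times those along the data, up to the error that one
more record can cause. -/
lemma relValue_sub_estDstl_le (hclass : M.GoodClass P.Pi) (hR : 1 ≤ M.R) (hc : 2 ≤ P.c)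
    (hd : 1 ≤ d) (hl : 1 / 2 ≤ P.logT)
    (h : P.Concentrated M x π d) {rmle : Reward S A} {πD : Policy S A} {rD : Reward S A}
    (hmle : P.IsMLE M x d rmle) (hrpo : P.IsRPO M x d πD rD) {π' : Policy S A}
    (hπ' : π' ∈ Bandit.hull P.Pi) {B : ℝ} (hB : 1 ≤ B)
    (hcov : ∀ r ∈ M.rewardClass P.Pi, M.pairExp π' (M.prefErr r) ^ 2
      ≤ B * (1 / (d : ℝ) * ∑ i ∈ Finset.range d, M.sqErr r (π i) + 4 * M.R ^ 2 / d)) :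
    M.relValue M.rstar π' - P.estDstl M x d rmle πD rD
      ≤ (3 * P.c + 8) * (M.R * Real.exp (2 * M.R) * B * √(1 / (d : ℝ) * P.logT)) := by
  have hη := eta_pos (M := M) hc hd hl
  have hd' : (0 : ℝ) < d := by exact_mod_cast hd
  have hp := (hclass.isPosPolicy_of_mem_hull hπ').1
  obtain ⟨r, hr, hobj⟩ := hrpo.2.2.2 π' hπ'
  have hml := hmle.2 _ hclass.rewardOf_optPolicy_mem
  rw [M.nll_rewardOf_optPolicy_rstar] at hml
  have hconc := h.nll_sub_le hd (by linarith) hr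
  have hcv := hcov r hr
  rw [← M.relValue_sub_relValue_rstar hp r] at hcv
  rw [rpoObj_eq] at hobj
  rw [estDstl_eq _ _ _ hη]
  set Q := 1 / (d : ℝ) * ∑ i ∈ Finset.range d, M.sqErr r (π i)
  set v := √(1 / (d : ℝ) * P.logT) with hv
  have hl0 : 0 < P.logT := by linarith
  have hv0 : 0 < v := Real.sqrt_pos.2 (by positivity)
  have hv2 : v ^ 2 = 1 / (d : ℝ) * P.logT := Real.sq_sqrt (by positivity)
  set η := P.eta M d with hηdef
  set k := minSlope M.R ^ 2 with hk
  have hκ := minSlope_pos M.R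
  have hk0 : 0 < k := by positivity
  set Y := Q + 4 * M.R ^ 2 / d with hY
  have hBY : 0 ≤ B * Y := le_trans (sq_nonneg _) hcv
  have hY0 : 0 ≤ Y := by
    by_contra hcon
    push Not at hcon
    nlinarith
  -- AM-GM trades the preference error under `π'` for the likelihood penalty of `r`.
  have hamgm : -(M.relValue r π' - M.relValue M.rstar π') ≤ B * η / (4 * k) + k * Y / η := by
    refine (abs_le_of_sq_le_sq' ?_ (by positivity)).2
    have h1 : (B * η / (4 * k) + k * Y / η) ^ 2
        = (B * η / (4 * k) - k * Y / η) ^ 2 + B * Y := by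
      field_simp
      ring
    rw [neg_sq, h1]
    nlinarith [sq_nonneg (B * η / (4 * k) - k * Y / η)]
  have hE : 1 ≤ Real.exp M.R := Real.one_le_exp (by linarith)
  have hRE : M.R ≤ Real.exp M.R := by linarith [Real.add_one_le_exp M.R]
  have hE2 : Real.exp (2 * M.R) = Real.exp M.R ^ 2 := by rw [← Real.exp_nat_mul]; norm_cast
  have herr := rpo_error_le hE hR hRE hc hB hl hd' hv0 hv2 hηdef hk
  rw [hE2]
  have hmain : k * Q / η - 2 * v ^ 2 / η + M.relValue r π'
      ≤ 1 / η * (P.rpoObj M x d πD rD - nll x d rmle) := by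
    have h1 : 1 / η * (k * Q - 2 * v ^ 2 + η * M.relValue r π')
        ≤ 1 / η * (P.rpoObj M x d πD rD - nll x d rmle) :=
      mul_le_mul_of_nonneg_left (by linarith) (by positivity)
    have h2 : 1 / η * (k * Q - 2 * v ^ 2 + η * M.relValue r π')
        = k * Q / η - 2 * v ^ 2 / η + M.relValue r π' := by field_simp
    linarith
  have hYe : k * Y / η = k * Q / η + k * (4 * M.R ^ 2 / d) / η := by
    rw [hY, mul_add, add_div]
  linarith

/-- The maximum likelihood estimator evaluates the policy of a source that has been visited up to
the exploration bonus. -/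
lemma abs_relValue_mle_sub_le (hclass : M.GoodClass P.Pi) (hR : 1 ≤ M.R)
    (hl : 0 ≤ P.logT) (hπ : ∀ i < d, IsPolicy (π i)) (h : P.Concentrated M x π d)
    {rmle : Reward S A} (hmle : P.IsMLE M x d rmle) (i : Fin P.W) (hv : P.visits M π d i ≠ 0)
    (hlW : P.logT ≤ P.logWT) :
    |M.relValue rmle (M.optPolicy (P.src i)) - M.relValue M.rstar (M.optPolicy (P.src i))|
      ≤ 16 * Real.exp (2 * M.R) * √(1 / (P.visits M π d i : ℝ) * P.logWT) := by
  classical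
  set p := M.optPolicy (P.src i) with hp
  have hpos := M.isPosPolicy_optPolicy (P.src i)
  set n := P.visits M π d i with hn
  have hn0 : (0 : ℝ) < n := by exact_mod_cast Nat.pos_of_ne_zero hv
  have hml := hmle.2 _ hclass.rewardOf_optPolicy_mem
  rw [M.nll_rewardOf_optPolicy_rstar] at hml
  have hsum : minSlope M.R ^ 2 * ∑ i ∈ Finset.range d, M.sqErr rmle (π i) ≤ 2 * P.logT := by
    have h1 := h rmle hmle.1
    have : 0 ≤ (d : ℝ) * (nll x d M.rstar - nll x d rmle) :=
      mul_nonneg (Nat.cast_nonneg _) (by linarith)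
    linarith
  have hvis : n * M.sqErr rmle p ≤ ∑ i ∈ Finset.range d, M.sqErr rmle (π i) := by
    calc (n : ℝ) * M.sqErr rmle p
        = ∑ j ∈ (Finset.range d).filter (fun j => π j = p), M.sqErr rmle (π j) := by
          rw [Finset.sum_congr rfl fun j hj => by rw [(Finset.mem_filter.1 hj).2],
            Finset.sum_const, nsmul_eq_mul, hn, visits]
      _ ≤ _ := Finset.sum_le_sum_of_subset_of_nonneg (Finset.filter_subset _ _)
          fun j hj _ => M.sqErr_nonneg _ (hπ j (Finset.mem_range.1 hj))
  have hcs := M.pairExp_sq_le p p hpos.1 hpos.2 (M.prefErr rmle)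
  rw [M.cov_self hpos, one_mul] at hcs
  change _ ≤ M.sqErr rmle p at hcs
  rw [M.relValue_sub_relValue_rstar hpos.1]
  have hE : 1 ≤ Real.exp M.R := Real.one_le_exp (by linarith)
  have hE2 : Real.exp (2 * M.R) = Real.exp M.R ^ 2 := by rw [← Real.exp_nat_mul]; norm_cast
  rw [hE2]
  set E := Real.exp M.R with hEdef
  have hκ : 1 ≤ 4 * E * minSlope M.R := by
    have : 4 * E * minSlope M.R = 4 * E ^ 2 / (1 + E) ^ 2 := by
      simp only [minSlope, ← hEdef]; ring
    rw [this, le_div_iff₀ (by positivity)]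
    nlinarith
  have hκ2 : 1 ≤ 16 * E ^ 2 * minSlope M.R ^ 2 := by nlinarith
  refine abs_le_of_sq_le_sq ?_ (by positivity)
  rw [mul_pow, Real.sq_sqrt (mul_nonneg (by positivity) (by linarith))]
  have hs0 : 0 ≤ M.sqErr rmle p := M.sqErr_nonneg _ hpos.1
  have h1 : n * M.sqErr rmle p ≤ 32 * E ^ 2 * P.logT := by
    have h2 := mul_le_mul_of_nonneg_left hvis (sq_nonneg (minSlope M.R))
    have h3 : n * M.sqErr rmle p ≤ 16 * E ^ 2 * minSlope M.R ^ 2 * (n * M.sqErr rmle p) :=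
      le_mul_of_one_le_left (by positivity) hκ2
    nlinarith [sq_nonneg E, mul_le_mul_of_nonneg_left (h2.trans hsum) (sq_nonneg E)]
  have h4 : 32 * E ^ 2 * P.logT ≤ (16 * E ^ 2) ^ 2 * P.logWT := by
    have : E ^ 2 * P.logT ≤ E ^ 4 * P.logWT := by
      apply mul_le_mul _ hlW hl (by positivity)
      exact pow_le_pow_right₀ hE (by norm_num)
    have h0 : 0 ≤ E ^ 2 * P.logT := by positivity
    nlinarith
  calc _ ≤ M.sqErr rmle p := hcs
    _ ≤ ((16 * E ^ 2) ^ 2 * P.logWT) / n := by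
      rw [le_div_iff₀ hn0]; linarith
    _ = _ := by ring

lemma le_capΔ {y z : ℝ} (hyz : y ≤ z) (hy : ∀ i, y ≤ P.Δ M i) : y ≤ P.capΔ M z := by
  have h1 : (y : EReal) ≤ min (⨅ i : Fin P.W, ((P.Δ M i : ℝ) : EReal)) (z : EReal) :=
    le_min (le_iInf fun i => EReal.coe_le_coe_iff.2 (hy i)) (EReal.coe_le_coe_iff.2 hyz)
  have h2 : min (⨅ i : Fin P.W, ((P.Δ M i : ℝ) : EReal)) (z : EReal) ≠ ⊤ :=
    ne_top_of_le_ne_top (EReal.coe_ne_top z) (min_le_right _ _)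
  have h3 := EReal.toReal_le_toReal h1 (EReal.coe_ne_bot y) h2
  simpa [capΔ] using h3

lemma Δ_nonneg (i : Fin P.W) : 0 ≤ P.Δ M i := M.gap_nonneg (M.isPosPolicy_optPolicy _).1

lemma IsTPS.isPosPolicy (hclass : M.GoodClass P.Pi) {p : Policy S A}
    (h : P.IsTPS M x π d p) : Bandit.IsPosPolicy p := by
  obtain ⟨rmle, πD, rD, -, hrpo, ⟨rfl, -⟩ | ⟨i, rfl, -⟩⟩ := h
  · exact hclass.isPosPolicy_of_mem_hull hrpo.1
  · exact M.isPosPolicy_optPolicy _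

/-- One transfer step. If the estimate of the distilled policy is `y`-optimal, the chosen policy
loses at most the value gap of the best source and `y`, except for a bonus that it pays only if it
is the policy of a source, and that shrinks with the number of visits to this source. -/
lemma IsTPS.gap_le (hclass : M.GoodClass P.Pi) (hR : 1 ≤ M.R) (hc : 2 ≤ P.c) (hd : 1 ≤ d)
    (hl : 1 / 2 ≤ P.logT) (hlW : 1 ≤ P.W → P.logT ≤ P.logWT)
    (hsrc : ∀ i s a, P.src i s a ∈ Set.Icc 0 M.R) (hπ : ∀ i < d, IsPolicy (π i))
    (hconc : P.Concentrated M x π d) {p : Policy S A} (h : P.IsTPS M x π d p) {y : ℝ}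
    (hy0 : 0 ≤ y)
    (hy : ∀ rmle πD rD, P.IsMLE M x d rmle → P.IsRPO M x d πD rD →
      M.relValue M.rstar (M.optPolicy M.rstar) - P.estDstl M x d rmle πD rD ≤ y) :
    M.gap p ≤ P.capΔ M y ∨ ∃ i, p = M.optPolicy (P.src i) ∧
      M.gap p ≤ P.capΔ M y
        + 64 * Real.exp (2 * M.R) * √P.logWT / √((P.visits M π d i : ℝ) + 1) := by
  have hX0 : 0 ≤ P.capΔ M y := le_capΔ hy0 Δ_nonneg
  obtain ⟨rmle, πD, rD, hmle, hrpo, hcase⟩ := h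
  -- Optimism: the estimate of each source is at least its value.
  have hopt : ∀ i, ((M.relValue M.rstar (M.optPolicy (P.src i)) : ℝ) : EReal)
      ≤ P.estSrc M π d rmle i := by
    intro i
    unfold estSrc
    split_ifs with hv
    · exact le_top
    · have h1 := abs_relValue_mle_sub_le hclass hR (by linarith) hπ hconc hmle i hv
        (hlW (Fin.pos i))
      refine EReal.coe_le_coe_iff.2 ?_
      have h2 := (abs_le.1 h1).1
      simp only [Bandit.relValue] at h2 ⊢
      linarith
  have hΔ : ∀ i, P.Δ M i = M.relValue M.rstar (M.optPolicy M.rstar)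
      - M.relValue M.rstar (M.optPolicy (P.src i)) := fun i => M.gap_eq_relValue _
  rcases hcase with ⟨rfl, hmax⟩ | ⟨i, rfl, hmax, hD⟩
  · left
    have hpess := estDstl_le hclass hR hc hd hl hπ hconc hmle hrpo
    have hyy := hy rmle p rD hmle hrpo
    rw [M.gap_eq_relValue]
    refine le_capΔ (by linarith) fun i => ?_
    have := EReal.coe_le_coe_iff.1 ((hopt i).trans (hmax i))
    rw [hΔ]
    linarith
  · right
    refine ⟨i, rfl, ?_⟩
    have hlW' := hlW (Fin.pos i)
    have hE : 1 ≤ Real.exp M.R := Real.one_le_exp (by linarith)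
    have hRE : M.R ≤ Real.exp M.R := by linarith [Real.add_one_le_exp M.R]
    have hE2 : Real.exp (2 * M.R) = Real.exp M.R ^ 2 := by rw [← Real.exp_nat_mul]; norm_cast
    by_cases hv : P.visits M π d i = 0
    -- At a first visit the estimate is infinite, and the trivial bound `2 R` on the gap is used.
    · have h1 := M.gap_optPolicy_le (hsrc i)
      have h2 : 1 / 2 ≤ √P.logWT := by
        refine Real.le_sqrt_of_sq_le ?_
        norm_num
        linarith
      rw [hv, hE2]
      simp only [Nat.cast_zero, zero_add, Real.sqrt_one, div_one]
      have h3 : Real.exp M.R ≤ Real.exp M.R ^ 2 := by nlinarith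
      nlinarith [mul_le_mul_of_nonneg_left h2 (sq_nonneg (Real.exp M.R))]
    · set b := 16 * Real.exp (2 * M.R) * √(1 / (P.visits M π d i : ℝ) * P.logWT) with hb
      have h1 := (abs_le.1 (abs_relValue_mle_sub_le hclass hR (by linarith) hπ hconc hmle i hv
        hlW')).2
      have he : P.estSrc M π d rmle i
          = ((M.relValue rmle (M.optPolicy (P.src i)) + b : ℝ) : EReal) := by
        simp only [estSrc, if_neg hv, Bandit.relValue, hb]
      rw [he] at hD hmax
      have hD' := EReal.coe_le_coe_iff.1 hD
      have hyy := hy rmle πD rD hmle hrpo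
      have hX : M.relValue M.rstar (M.optPolicy M.rstar)
          - (M.relValue rmle (M.optPolicy (P.src i)) + b) ≤ P.capΔ M y := by
        refine le_capΔ (by linarith) fun j => ?_
        have := EReal.coe_le_coe_iff.1 ((hopt j).trans (hmax j))
        rw [hΔ]
        linarith
      have hbound : 2 * b
          ≤ 64 * Real.exp (2 * M.R) * √P.logWT / √((P.visits M π d i : ℝ) + 1) := by
        set n := P.visits M π d i
        have hn : (1 : ℝ) ≤ n := by exact_mod_cast Nat.one_le_iff_ne_zero.2 hv
        have h3 : √(1 / (n : ℝ) * P.logWT) ≤ 2 * (√P.logWT / √((n : ℝ) + 1)) := by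
          rw [← Real.sqrt_div (by linarith)]
          refine Real.sqrt_le_iff.2 ⟨by positivity, ?_⟩
          rw [mul_pow, Real.sq_sqrt (div_nonneg (by linarith) (by positivity)),
            one_div_mul_eq_div, ← mul_div_assoc, div_le_div_iff₀ (by positivity) (by positivity)]
          have : 0 ≤ P.logWT := by linarith
          nlinarith
        rw [hb, mul_div_assoc]
        nlinarith [mul_le_mul_of_nonneg_left h3 (Real.exp_pos (2 * M.R)).le]
      rw [M.gap_eq_relValue]
      linarith [abs_le.1 (abs_relValue_mle_sub_le hclass hR (by linarith) hπ hconc hmle i hv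
        hlW')]

end Config

/-! ### The schedule of online and transfer iterations -/

namespace Config

variable {S : Type u} {A : Type v} {P : Config S A}

/-- The number of online iterations among the first `t` ones. -/
def onlineCount (P : Config S A) (t : ℕ) : ℕ := (t / P.N) * P.m + min (t % P.N) P.m

lemma onlineTime_onlineCount {t : ℕ} (h : t % P.N < P.m) : P.onlineTime (P.onlineCount t) = t := by
  have hm : 0 < P.m := by omega
  rw [onlineTime, onlineCount, min_eq_left h.le, mul_comm (t / P.N) P.m,
    Nat.mul_add_div hm, Nat.div_eq_of_lt h, Nat.mul_add_mod, Nat.mod_eq_of_lt h, add_zero]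
  exact Nat.div_add_mod' t P.N

lemma onlineCount_succ (hN : P.m < P.N) (t : ℕ) :
    P.onlineCount (t + 1) = P.onlineCount t + if t % P.N < P.m then 1 else 0 := by
  have h0 : 0 < P.N := by omega
  have hlt := Nat.mod_lt t h0
  have ht := Nat.div_add_mod' t P.N
  by_cases h : t % P.N + 1 < P.N
  · have h1 : (t + 1) / P.N = t / P.N := by
      rw [← ht, add_assoc, mul_comm, Nat.mul_add_div h0, Nat.mul_add_div h0, Nat.div_eq_of_lt h,
        Nat.div_eq_of_lt hlt]
    have h2 : (t + 1) % P.N = t % P.N + 1 := by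
      conv_lhs => rw [← ht, add_assoc, mul_comm, Nat.mul_add_mod, Nat.mod_eq_of_lt h]
    simp only [onlineCount, h1, h2]
    split_ifs <;> omega
  · have he : t + 1 = P.N * (t / P.N + 1) := by
      have : t % P.N + 1 = P.N := by omega
      rw [mul_add, mul_one, mul_comm]
      omega
    have h1 : (t + 1) / P.N = t / P.N + 1 := by rw [he, Nat.mul_div_cancel_left _ h0]
    have h2 : (t + 1) % P.N = 0 := by rw [he, Nat.mul_mod_right]
    simp only [onlineCount, h1, h2, add_mul]
    split_ifs <;> omega

lemma sum_onlineSteps (hN : P.m < P.N) (f : ℕ → ℝ) (t : ℕ) :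
    ∑ i ∈ P.onlineSteps t, f i = ∑ j ∈ Finset.range (P.onlineCount t), f (P.onlineTime j) := by
  induction t with
  | zero => simp [onlineSteps, onlineCount]
  | succ t ih =>
    rw [onlineSteps, Finset.sum_filter] at ih ⊢
    rw [Finset.sum_range_succ, ih, onlineCount_succ hN]
    split_ifs with h
    · rw [Finset.sum_range_succ, onlineTime_onlineCount h]
    · simp

lemma card_onlineSteps (hN : P.m < P.N) (t : ℕ) : (P.onlineSteps t).card = P.onlineCount t := by
  have := sum_onlineSteps hN (fun _ => 1) t
  simpa using this

lemma sum_onlineSteps_add_sum_transferSteps (f : ℕ → ℝ) (t : ℕ) :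
    ∑ i ∈ P.onlineSteps t, f i + ∑ i ∈ P.transferSteps t, f i = ∑ i ∈ Finset.range t, f i := by
  simp only [onlineSteps, transferSteps, ← not_lt]
  exact Finset.sum_filter_add_sum_filter_not _ _ _

lemma α_mul_le_onlineCount (hN : P.m < P.N) (t : ℕ) : P.α * t ≤ P.onlineCount t := by
  have h0 : (0 : ℝ) < P.N := by exact_mod_cast (by omega : 0 < P.N)
  rw [α, div_mul_eq_mul_div, div_le_iff₀ h0]
  have h : P.m * t ≤ P.onlineCount t * P.N := by
    have ht := Nat.div_add_mod' t P.N
    have hlt := Nat.mod_lt t (by omega : 0 < P.N)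
    have h1 : P.m * (t % P.N) ≤ min (t % P.N) P.m * P.N := by
      rcases le_total (t % P.N) P.m with h | h
      · rw [min_eq_left h, mul_comm]; exact Nat.mul_le_mul_left _ hN.le
      · rw [min_eq_right h]; exact Nat.mul_le_mul_left _ hlt.le
    calc P.m * t = P.m * (t / P.N * P.N + t % P.N) := by rw [ht]
      _ = t / P.N * P.m * P.N + P.m * (t % P.N) := by ring
      _ ≤ t / P.N * P.m * P.N + min (t % P.N) P.m * P.N := by omega
      _ = _ := by rw [onlineCount]; ring
  exact_mod_cast h

lemma onlineCount_le_two_mul (hN : P.m < P.N) {t : ℕ} (ht : P.N ≤ t) :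
    (P.onlineCount t : ℝ) ≤ 2 * (P.α * t) := by
  have h0 : (0 : ℝ) < P.N := by exact_mod_cast (by omega : 0 < P.N)
  rw [α, div_mul_eq_mul_div, ← mul_div_assoc, le_div_iff₀ h0]
  have h : P.onlineCount t * P.N ≤ 2 * (P.m * t) := by
    have hd := Nat.div_add_mod' t P.N
    have h1 : 1 ≤ t / P.N := (Nat.one_le_div_iff (by omega)).2 ht
    calc P.onlineCount t * P.N ≤ (t / P.N * P.m + P.m) * P.N :=
          Nat.mul_le_mul_right _ (Nat.add_le_add_left (min_le_right _ _) _)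
      _ ≤ (t / P.N * P.m + t / P.N * P.m) * P.N :=
          Nat.mul_le_mul_right _ (Nat.add_le_add_left (Nat.le_mul_of_pos_left _ h1) _)
      _ = 2 * (P.m * (t / P.N * P.N)) := by ring
      _ ≤ 2 * (P.m * t) := by gcongr; omega
  exact_mod_cast h

lemma onlineCount_le {t : ℕ} (ht : t ≤ P.T) : P.onlineCount t ≤ P.K * P.m := by
  rcases Nat.eq_zero_or_pos P.N with h0 | h0
  · have : t = 0 := by simpa [T, h0] using ht
    simp [onlineCount, this]
  have hd := Nat.div_add_mod' t P.N
  have h1 : t / P.N ≤ P.K := Nat.div_le_of_le_mul (by rw [mul_comm]; exact ht)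
  rcases h1.eq_or_lt with h | h
  · have h2 : t % P.N = 0 := by
      rw [h] at hd
      simp only [T] at ht
      omega
    simp [onlineCount, h, h2]
  · calc P.onlineCount t ≤ t / P.N * P.m + P.m := Nat.add_le_add_left (min_le_right _ _) _
      _ = (t / P.N + 1) * P.m := by ring
      _ ≤ P.K * P.m := Nat.mul_le_mul_right _ h

lemma onlineTime_lt_succ (hm : 0 < P.m) (hN : P.m < P.N) (j : ℕ) :
    P.onlineTime j < P.onlineTime (j + 1) := by
  have hj := Nat.div_add_mod' j P.m
  have hlt := Nat.mod_lt j hm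
  by_cases h : j % P.m + 1 < P.m
  · have h1 : (j + 1) / P.m = j / P.m := by
      rw [← hj, add_assoc, mul_comm, Nat.mul_add_div hm, Nat.mul_add_div hm, Nat.div_eq_of_lt h,
        Nat.div_eq_of_lt hlt]
    have h2 : (j + 1) % P.m = j % P.m + 1 := by
      conv_lhs => rw [← hj, add_assoc, mul_comm, Nat.mul_add_mod, Nat.mod_eq_of_lt h]
    simp only [onlineTime, h1, h2]
    omega
  · have he : j + 1 = P.m * (j / P.m + 1) := by
      rw [mul_add, mul_one, mul_comm]
      omega
    have h1 : (j + 1) / P.m = j / P.m + 1 := by rw [he, Nat.mul_div_cancel_left _ hm]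
    simp only [onlineTime, h1, add_mul]
    omega

lemma onlineTime_lt_T (hm : 0 < P.m) (hN : P.m < P.N) {j : ℕ} (hj : j < P.K * P.m) :
    P.onlineTime j < P.T := by
  have h1 : j / P.m < P.K := (Nat.div_lt_iff_lt_mul hm).2 hj
  have hlt := Nat.mod_lt j hm
  calc P.onlineTime j < j / P.m * P.N + P.N := by simp only [onlineTime]; omega
    _ = (j / P.m + 1) * P.N := by ring
    _ ≤ P.K * P.N := Nat.mul_le_mul_right _ h1

lemma card_transferSteps_le (hN : P.m < P.N) (t : ℕ) :
    ((P.transferSteps t).card : ℝ) ≤ (1 - P.α) * t := by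
  have h := sum_onlineSteps_add_sum_transferSteps (P := P) (fun _ => 1) t
  simp only [Finset.sum_const, nsmul_eq_mul, mul_one, card_onlineSteps hN,
    Finset.card_range] at h
  linarith [α_mul_le_onlineCount hN t]

lemma α_pos (hm : 0 < P.m) (hN : P.m < P.N) : 0 < P.α := by
  have : (0 : ℝ) < P.m := by exact_mod_cast hm
  have : (0 : ℝ) < P.N := by exact_mod_cast hm.trans hN
  exact div_pos ‹_› ‹_›

lemma α_le_one (hN : P.m < P.N) : P.α ≤ 1 :=
  div_le_one_of_le₀ (by exact_mod_cast hN.le) (Nat.cast_nonneg _)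

end Config

/-! ### Summing exploration bonuses -/

lemma sum_inv_sqrt_le (G : Finset ℕ) : ∑ k ∈ G, 1 / √((k : ℝ) + 1) ≤ 2 * √(G.card : ℝ) := by
  induction G using Finset.induction_on_max with
  | empty => simp
  | insert a s hs ih =>
    have ha : a ∉ s := fun h => lt_irrefl _ (hs a h)
    have hcard : s.card ≤ a := by
      have : s ⊆ Finset.range a := fun k hk => Finset.mem_range.2 (hs k hk)
      simpa using Finset.card_le_card this
    rw [Finset.sum_insert ha, Finset.card_insert_of_notMem ha, Nat.cast_add, Nat.cast_one]
    set n : ℝ := (s.card : ℝ) with hn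
    have hn0 : 0 ≤ n := Nat.cast_nonneg _
    have h1 : √(n + 1) ≤ √((a : ℝ) + 1) := Real.sqrt_le_sqrt (by
      have : n ≤ a := Nat.cast_le.2 hcard
      linarith)
    have hp : 0 < √(n + 1) := Real.sqrt_pos.2 (by linarith)
    have h2 : 1 / √((a : ℝ) + 1) ≤ 1 / √(n + 1) := one_div_le_one_div_of_le hp h1
    have h3 : 1 / √(n + 1) ≤ 2 * (√(n + 1) - √n) := by
      rw [div_le_iff₀ hp]
      have e1 := Real.sq_sqrt hn0
      have e2 := Real.sq_sqrt (by linarith : 0 ≤ n + 1)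
      nlinarith [sq_nonneg (√(n + 1) - √n)]
    linarith

section Bonus

variable {W : ℕ} {F : Finset ℕ} {g X : ℕ → ℝ} {Δ : Fin W → ℝ} {b : ℝ} {v : ℕ → Fin W → ℕ}
  {sel : ℕ → Fin W → Prop}

/-- Each step without a bonus is charged to nothing, and each other step to one source. -/
lemma exists_label (h : ∀ i ∈ F, g i ≤ X i ∨
      ∃ j, sel i j ∧ g i = Δ j ∧ g i ≤ X i + b / √((v i j : ℝ) + 1)) :
    ∃ lab : ℕ → Option (Fin W), ∀ i ∈ F, (lab i = none → g i ≤ X i) ∧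
      ∀ j, lab i = some j → sel i j ∧ g i = Δ j ∧ g i ≤ X i + b / √((v i j : ℝ) + 1) := by
  classical
  choose f hf using fun i (hi : i ∈ F ∧ ¬ g i ≤ X i) => (h i hi.1).resolve_left hi.2
  refine ⟨fun i => if hi : i ∈ F ∧ ¬ g i ≤ X i then some (f i hi) else none, fun i hi => ⟨?_, ?_⟩⟩
  · intro hn
    by_contra hc
    simp [hi, not_le.1 hc] at hn
  · intro j hj
    by_cases hc : i ∈ F ∧ ¬ g i ≤ X i
    · simp only [dif_pos hc, Option.some.injEq] at hj
      rw [← hj]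
      exact hf i hc
    · exact absurd hj (by simp only [dif_neg hc, reduceCtorEq, not_false_eq_true])

lemma sum_eq_sum_labels (lab : ℕ → Option (Fin W)) (f : ℕ → ℝ) :
    ∑ i ∈ F, f i = ∑ i ∈ F with lab i = none, f i
      + ∑ j, ∑ i ∈ F with lab i = some j, f i := by
  rw [← Finset.sum_fiberwise F lab f, Fintype.sum_option]

lemma visits_injOn (hv : ∀ j, ∀ i ∈ F, ∀ i' ∈ F, sel i j → i < i' → v i j < v i' j)
    {G : Finset ℕ} {j : Fin W} (hG : ∀ i ∈ G, i ∈ F ∧ sel i j) :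
    Set.InjOn (fun i => v i j) (G : Set ℕ) := by
  intro i hi i' hi' he
  by_contra hne
  obtain ⟨h1, h2⟩ := hG i hi
  obtain ⟨h3, h4⟩ := hG i' hi'
  rcases lt_or_gt_of_ne hne with h | h
  · exact (hv j i h1 i' h3 h2 h).ne he
  · exact (hv j i' h3 i h1 h4 h).ne' he

/-- The minimax bound: bonuses of one source sum to the root of the number of its selections, and
then the Cauchy-Schwarz inequality is applied over the sources. -/
lemma sum_le_add_sqrt (hb : 0 ≤ b)
    (h : ∀ i ∈ F, g i ≤ X i ∨ ∃ j, sel i j ∧ g i = Δ j ∧ g i ≤ X i + b / √((v i j : ℝ) + 1))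
    (hv : ∀ j, ∀ i ∈ F, ∀ i' ∈ F, sel i j → i < i' → v i j < v i' j) :
    ∑ i ∈ F, g i ≤ ∑ i ∈ F, X i + 2 * b * √((W : ℝ) * F.card) := by
  obtain ⟨lab, hlab⟩ := exists_label h
  rw [sum_eq_sum_labels lab g, sum_eq_sum_labels lab X]
  have h0 : ∑ i ∈ F with lab i = none, g i ≤ ∑ i ∈ F with lab i = none, X i :=
    Finset.sum_le_sum fun i hi => (hlab i (Finset.mem_filter.1 hi).1).1 (Finset.mem_filter.1 hi).2
  have h1 : ∀ j, ∑ i ∈ F with lab i = some j, g i ≤ ∑ i ∈ F with lab i = some j, X i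
      + 2 * b * √((F.filter fun i => lab i = some j).card : ℝ) := by
    intro j
    set G := F.filter fun i => lab i = some j with hG
    have hGm : ∀ i ∈ G, i ∈ F ∧ sel i j := fun i hi =>
      ⟨(Finset.mem_filter.1 hi).1,
        ((hlab i (Finset.mem_filter.1 hi).1).2 j (Finset.mem_filter.1 hi).2).1⟩
    have hinj := visits_injOn hv hGm
    have hsum : ∑ i ∈ G, 1 / √((v i j : ℝ) + 1) ≤ 2 * √(G.card : ℝ) := by
      have := sum_inv_sqrt_le (G.image fun i => v i j)
      rwa [Finset.sum_image hinj, Finset.card_image_of_injOn hinj] at this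
    calc ∑ i ∈ G, g i ≤ ∑ i ∈ G, (X i + b * (1 / √((v i j : ℝ) + 1))) :=
          Finset.sum_le_sum fun i hi => by
            have := ((hlab i (Finset.mem_filter.1 hi).1).2 j (Finset.mem_filter.1 hi).2).2.2
            rwa [mul_one_div]
      _ = ∑ i ∈ G, X i + b * ∑ i ∈ G, 1 / √((v i j : ℝ) + 1) := by
          rw [Finset.sum_add_distrib, Finset.mul_sum]
      _ ≤ _ := by nlinarith [mul_le_mul_of_nonneg_left hsum hb]
  have h2 : ∑ j, √((F.filter fun i => lab i = some j).card : ℝ) ≤ √((W : ℝ) * F.card) := by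
    have hc : ∑ j : Fin W, ((F.filter fun i => lab i = some j).card : ℝ) ≤ F.card := by
      have := sum_eq_sum_labels (F := F) lab (fun _ => 1)
      simp only [Finset.sum_const, nsmul_eq_mul, mul_one] at this
      rw [this]
      exact le_add_of_nonneg_left (Nat.cast_nonneg _)
    refine Real.le_sqrt_of_sq_le ?_
    calc (∑ j, √((F.filter fun i => lab i = some j).card : ℝ)) ^ 2
        ≤ (Finset.univ : Finset (Fin W)).card
          * ∑ j, √((F.filter fun i => lab i = some j).card : ℝ) ^ 2 :=
          sq_sum_le_card_mul_sum_sq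
      _ = (W : ℝ) * ∑ j : Fin W, ((F.filter fun i => lab i = some j).card : ℝ) := by
          simp only [Finset.card_univ, Fintype.card_fin, Real.sq_sqrt (Nat.cast_nonneg _)]
      _ ≤ (W : ℝ) * F.card := mul_le_mul_of_nonneg_left hc (Nat.cast_nonneg _)
  have h3 := Finset.sum_le_sum fun j (_ : j ∈ Finset.univ) => h1 j
  rw [Finset.sum_add_distrib, ← Finset.mul_sum] at h3
  have h4 := mul_le_mul_of_nonneg_left h2 (by positivity : 0 ≤ 2 * b)
  linarith

/-- The gap-dependent bound: a step that selects a source of gap `Δ > 0` and does not lose at most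
`2 X` has a bonus of at least `Δ / 2`, which happens for at most `4 b² / Δ²` visit counts. -/
lemma sum_le_add_inv_gap (hX : ∀ i ∈ F, 0 ≤ X i) (hΔ : ∀ j, 0 ≤ Δ j)
    (h : ∀ i ∈ F, g i ≤ X i ∨ ∃ j, sel i j ∧ g i = Δ j ∧ g i ≤ X i + b / √((v i j : ℝ) + 1))
    (hv : ∀ j, ∀ i ∈ F, ∀ i' ∈ F, sel i j → i < i' → v i j < v i' j) :
    ∑ i ∈ F, g i ≤ 2 * ∑ i ∈ F, X i + ∑ j with 0 < Δ j, 4 * b ^ 2 / Δ j := by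
  obtain ⟨lab, hlab⟩ := exists_label h
  rw [sum_eq_sum_labels lab g, sum_eq_sum_labels lab X]
  have h0 : ∑ i ∈ F with lab i = none, g i ≤ 2 * ∑ i ∈ F with lab i = none, X i := by
    rw [Finset.mul_sum]
    refine Finset.sum_le_sum fun i hi => ?_
    have h1 := (hlab i (Finset.mem_filter.1 hi).1).1 (Finset.mem_filter.1 hi).2
    linarith [hX i (Finset.mem_filter.1 hi).1]
  have h1 : ∀ j, ∑ i ∈ F with lab i = some j, g i ≤ 2 * ∑ i ∈ F with lab i = some j, X i
      + if 0 < Δ j then 4 * b ^ 2 / Δ j else 0 := by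
    intro j
    set G := F.filter fun i => lab i = some j with hG
    have hGm : ∀ i ∈ G, i ∈ F ∧ sel i j ∧ g i = Δ j ∧ g i ≤ X i + b / √((v i j : ℝ) + 1) :=
      fun i hi => ⟨(Finset.mem_filter.1 hi).1,
        (hlab i (Finset.mem_filter.1 hi).1).2 j (Finset.mem_filter.1 hi).2⟩
    have hXG : 0 ≤ 2 * ∑ i ∈ G, X i :=
      mul_nonneg zero_le_two (Finset.sum_nonneg fun i hi => hX i (hGm i hi).1)
    split_ifs with hpos
    · set H := G.filter fun i => 2 * X i < Δ j with hH
      have hHm : ∀ i ∈ H, i ∈ G ∧ 2 * X i < Δ j := fun i hi => Finset.mem_filter.1 hi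
      have hcard : (H.card : ℝ) ≤ 4 * b ^ 2 / Δ j ^ 2 := by
        have hinj : Set.InjOn (fun i => v i j) (H : Set ℕ) :=
          visits_injOn hv fun i hi => ⟨(hGm i (hHm i hi).1).1, (hGm i (hHm i hi).1).2.1⟩
        have hsub : H.image (fun i => v i j) ⊆ Finset.range ⌊4 * b ^ 2 / Δ j ^ 2⌋₊ := by
          intro k hk
          obtain ⟨i, hi, rfl⟩ := Finset.mem_image.1 hk
          obtain ⟨-, -, hgi, hle⟩ := hGm i (hHm i hi).1
          have hlt := (hHm i hi).2
          refine Finset.mem_range.2 (Nat.lt_of_succ_le (Nat.le_floor ?_))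
          have hp : 0 < √((v i j : ℝ) + 1) := Real.sqrt_pos.2 (by positivity)
          have h2 : Δ j * √((v i j : ℝ) + 1) ≤ 2 * b := by
            have : Δ j ≤ 2 * b / √((v i j : ℝ) + 1) := by
              rw [mul_div_assoc]; linarith
            rwa [le_div_iff₀ hp] at this
          have h3 : (Δ j * √((v i j : ℝ) + 1)) ^ 2 ≤ (2 * b) ^ 2 :=
            pow_le_pow_left₀ (by positivity) h2 2
          rw [mul_pow, Real.sq_sqrt (by positivity)] at h3
          rw [le_div_iff₀ (by positivity)]
          push_cast
          linarith
        have h2 := Finset.card_le_card hsub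
        rw [Finset.card_image_of_injOn hinj, Finset.card_range] at h2
        exact (Nat.cast_le.2 h2).trans (Nat.floor_le (by positivity))
      calc ∑ i ∈ G, g i ≤ ∑ i ∈ G, (2 * X i + if 2 * X i < Δ j then Δ j else 0) := by
            refine Finset.sum_le_sum fun i hi => ?_
            obtain ⟨hiF, -, hgi, -⟩ := hGm i hi
            have := hX i hiF
            split_ifs <;> linarith
        _ = 2 * ∑ i ∈ G, X i + H.card * Δ j := by
            rw [Finset.sum_add_distrib, ← Finset.mul_sum, ← Finset.sum_filter, Finset.sum_const,
              nsmul_eq_mul]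
        _ ≤ 2 * ∑ i ∈ G, X i + 4 * b ^ 2 / Δ j ^ 2 * Δ j := by gcongr
        _ = _ := by field_simp
    · have hz : Δ j = 0 := le_antisymm (not_lt.1 hpos) (hΔ j)
      have : ∑ i ∈ G, g i = 0 := Finset.sum_eq_zero fun i hi => by rw [(hGm i hi).2.2.1, hz]
      rw [this]
      linarith
  have h3 := Finset.sum_le_sum fun j (_ : j ∈ Finset.univ) => h1 j
  rw [Finset.sum_add_distrib, ← Finset.mul_sum, ← Finset.sum_filter] at h3
  linarith

end Bonus

/-! ### Regret bounds on the good event -/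

namespace Config

variable {S : Type u} {A : Type v} [Fintype S] [Fintype A] {P : Config S A} {M : Bandit S A}
  {x : ℕ → Outcome S A} {π : ℕ → Policy S A}

/-- The numerical constant of the regret bound. Here `16384 = 4 · 64²` comes from the squared
bonuses, `2 COL` from the no-regret bound, and the last term from the error of the distilled policy,
where `2 ^ c₀` pays for replacing `log` by `log ^ c₀`. -/
noncomputable def regretConst (COL c₀ c : ℝ) : ℝ :=
  16384 + 2 * COL + 2 * (3 * c + 8) * 2 ^ c₀

lemma le_two_rpow_mul_rpow {l c₀ : ℝ} (hl : 1 / 2 ≤ l) (hc₀ : 1 ≤ c₀) : l ≤ 2 ^ c₀ * l ^ c₀ := by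
  rw [← Real.mul_rpow (by norm_num) (by linarith)]
  have := Real.self_le_rpow_of_one_le (by linarith : 1 ≤ 2 * l) hc₀
  linarith

/-- The properties of a run on the good event: the policies are genuine, those of the online
iterations lie in the hull and satisfy the no-regret bound, the transfer iterations follow transfer
policy selection, and the maximum likelihood event holds throughout. -/
structure GoodRun (P : Config S A) (M : Bandit S A) (COL c₀ 𝒞 : ℝ) (x : ℕ → Outcome S A)
    (π : ℕ → Policy S A) : Prop where
  isPosPolicy : ∀ i < P.T, Bandit.IsPosPolicy (π i)
  mem_hull : ∀ i < P.T, i % P.N < P.m → π i ∈ Bandit.hull P.Pi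
  isTPS : ∀ i < P.T, P.m ≤ i % P.N → P.IsTPS M x π i (π i)
  concentrated : ∀ d < P.T, 1 ≤ d → P.Concentrated M x π d
  online : ∀ t : ℕ, 1 ≤ t → t ≤ P.K * P.m →
    ∑ j ∈ Finset.range t, M.gap (π (P.onlineTime j)) ≤ COL * M.R * Real.exp (2 * M.R) *
      √(𝒞 * t * Real.log ((P.Pi.card : ℝ) * ((P.K * P.m : ℕ) : ℝ) / P.δ) ^ c₀)

/-- The standing assumptions on an instance. -/
structure Admissible (P : Config S A) (M : Bandit S A) (COL c₀ 𝒞 : ℝ) : Prop where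
  COL_pos : 0 < COL
  one_le_c₀ : 1 ≤ c₀
  two_le_c : 2 ≤ P.c
  one_le_R : 1 ≤ M.R
  one_le_𝒞 : 1 ≤ 𝒞
  good : M.GoodClass P.Pi
  src_mem : ∀ i s a, P.src i s a ∈ Set.Icc 0 M.R
  m_pos : 0 < P.m
  m_lt : P.m < P.N
  K_pos : 0 < P.K
  δ_pos : 0 < P.δ
  δ_lt : P.δ < 1

variable {COL c₀ 𝒞 : ℝ}

namespace Admissible

lemma nonempty (h : P.Admissible M COL c₀ 𝒞) : P.Pi.Nonempty := ⟨_, h.good.realizable⟩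

lemma two_le_T (h : P.Admissible M COL c₀ 𝒞) : 2 ≤ P.T := by
  have h1 := h.m_pos
  have h2 := h.m_lt
  have h3 := Nat.le_mul_of_pos_left P.N h.K_pos
  simp only [T]
  omega

lemma half_le_logT (h : P.Admissible M COL c₀ 𝒞) : 1 / 2 ≤ P.logT :=
  Config.half_le_logT h.nonempty h.two_le_T h.δ_pos h.δ_lt

lemma logT_le_logWT (h : P.Admissible M COL c₀ 𝒞) (hW : 1 ≤ P.W) : P.logT ≤ P.logWT :=
  Config.logT_le_logWT h.nonempty h.two_le_T h.δ_pos h.δ_lt hW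

/-- The guarantee of the online learner in terms of the horizon of the whole run. -/
lemma online_le (h : P.Admissible M COL c₀ 𝒞) (hrun : P.GoodRun M COL c₀ 𝒞 x π) {t : ℕ}
    (ht1 : 1 ≤ P.onlineCount t) (ht : t ≤ P.T) :
    ∑ i ∈ P.onlineSteps t, M.gap (π i)
      ≤ COL * M.R * Real.exp (2 * M.R) * √(𝒞 * P.onlineCount t * P.logT ^ c₀) := by
  rw [sum_onlineSteps h.m_lt]
  refine (hrun.online _ ht1 (onlineCount_le ht)).trans ?_
  have hR := h.one_le_R
  have hC := h.COL_pos
  have h𝒞 := h.one_le_𝒞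
  have hKm : (1 : ℝ) ≤ ((P.K * P.m : ℕ) : ℝ) := by
    exact_mod_cast Nat.mul_pos h.K_pos h.m_pos
  have hcard : (1 : ℝ) ≤ P.Pi.card := by exact_mod_cast h.nonempty.card_pos
  have h1 : 1 ≤ (P.Pi.card : ℝ) * ((P.K * P.m : ℕ) : ℝ) / P.δ := by
    rw [le_div_iff₀ h.δ_pos]
    nlinarith [h.δ_lt]
  have h2 : Real.log ((P.Pi.card : ℝ) * ((P.K * P.m : ℕ) : ℝ) / P.δ) ≤ P.logT := by
    refine Real.log_le_log (by linarith) (div_le_div_of_nonneg_right ?_ h.δ_pos.le)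
    refine mul_le_mul_of_nonneg_left ?_ (by linarith)
    exact_mod_cast Nat.mul_le_mul_left _ h.m_lt.le
  have h3 := Real.rpow_le_rpow (Real.log_nonneg h1) h2 (zero_le_one.trans h.one_le_c₀)
  refine mul_le_mul_of_nonneg_left (Real.sqrt_le_sqrt ?_) (by positivity)
  exact mul_le_mul_of_nonneg_left h3 (by positivity)

lemma online_regret_le (h : P.Admissible M COL c₀ 𝒞) (hrun : P.GoodRun M COL c₀ 𝒞 x π) {t : ℕ}
    (htN : P.N ≤ t) (ht : t ≤ P.T) {C : ℝ} (hC : 2 * COL ≤ C) :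
    ∑ i ∈ P.onlineSteps t, M.gap (π i) ≤ P.regOL M C c₀ 𝒞 t := by
  have hα := α_pos h.m_pos h.m_lt
  have ht0 : (0 : ℝ) < t := by exact_mod_cast (h.m_pos.trans h.m_lt).trans_le htN
  have hn : 1 ≤ P.onlineCount t := by
    have := α_mul_le_onlineCount h.m_lt t
    have h1 : (0 : ℝ) < P.onlineCount t := lt_of_lt_of_le (by positivity) this
    exact_mod_cast h1
  refine (h.online_le hrun hn ht).trans ?_
  have hl := h.half_le_logT
  have hR := h.one_le_R
  have h𝒞 := h.one_le_𝒞
  have hC0 := h.COL_pos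
  have hz : 0 ≤ P.logT ^ c₀ := Real.rpow_nonneg (by linarith) _
  have h1 : √(𝒞 * P.onlineCount t * P.logT ^ c₀) ≤ 2 * √(P.α * 𝒞 * t * P.logT ^ c₀) := by
    refine Real.sqrt_le_iff.2 ⟨by positivity, ?_⟩
    rw [mul_pow, Real.sq_sqrt (by positivity)]
    have h2 := onlineCount_le_two_mul h.m_lt htN
    have h3 : 0 ≤ 𝒞 * P.logT ^ c₀ := by positivity
    have h4 : 0 ≤ P.α * t * (𝒞 * P.logT ^ c₀) := by positivity
    nlinarith [mul_le_mul_of_nonneg_left h2 h3]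
  unfold regOL
  calc COL * M.R * Real.exp (2 * M.R) * √(𝒞 * P.onlineCount t * P.logT ^ c₀)
      ≤ COL * M.R * Real.exp (2 * M.R) * (2 * √(P.α * 𝒞 * t * P.logT ^ c₀)) := by gcongr
    _ = 2 * COL * (M.R * Real.exp (2 * M.R) * √(P.α * 𝒞 * t * P.logT ^ c₀)) := by ring
    _ ≤ _ := by gcongr

/-- Replacing the confidence radius of `d` records by the one that appears in the bounds, for `d` or
`d + 1` records. -/
lemma sqrt_radius_le (h : P.Admissible M COL c₀ 𝒞) {d d' : ℕ} (hd : 1 ≤ d) (hd1 : d' ≤ d + 1)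
    (hd0 : d ≤ d') :
    √(1 / (d : ℝ) * P.logT) ≤ 2 * 2 ^ c₀ * √(1 / (d' : ℝ) * P.logT ^ c₀) := by
  have hl := h.half_le_logT
  have hz : 0 ≤ P.logT ^ c₀ := Real.rpow_nonneg (by linarith) _
  have hq : (1 : ℝ) ≤ 2 ^ c₀ := Real.one_le_rpow (by norm_num) (by linarith [h.one_le_c₀])
  have hdr : (1 : ℝ) ≤ d := by exact_mod_cast hd
  have hd'r : (d' : ℝ) ≤ d + 1 := by exact_mod_cast hd1
  have hd'0 : (0 : ℝ) < d' := by exact_mod_cast hd.trans hd0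
  refine Real.sqrt_le_iff.2 ⟨by positivity, ?_⟩
  rw [mul_pow, Real.sq_sqrt (by positivity)]
  have h1 : 1 / (d : ℝ) ≤ 2 * (1 / (d' : ℝ)) := by
    rw [mul_one_div, div_le_div_iff₀ (by linarith) hd'0]
    linarith
  have h2 := le_two_rpow_mul_rpow hl h.one_le_c₀
  calc 1 / (d : ℝ) * P.logT ≤ 2 * (1 / (d' : ℝ)) * (2 ^ c₀ * P.logT ^ c₀) := by
        gcongr
    _ = 2 * 2 ^ c₀ * 1 * (1 / (d' : ℝ) * P.logT ^ c₀) := by ring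
    _ ≤ 2 * 2 ^ c₀ * (2 * 2 ^ c₀) * (1 / (d' : ℝ) * P.logT ^ c₀) := by
        gcongr
        linarith
    _ = _ := by ring

/-- Mixtures of the policies of a run have full support, so the ratios in the coverage coefficient
never divide by zero. -/
lemma isPosPolicy_mix (hrun : P.GoodRun M COL c₀ 𝒞 x π) {d : ℕ} (hd : 1 ≤ d) (hdT : d ≤ P.T) :
    Bandit.IsPosPolicy (mix π d) := by
  have := Bandit.IsPosPolicy.average (F := Finset.range d)
    ⟨0, Finset.mem_range.2 hd⟩ π fun i hi =>
      hrun.isPosPolicy i ((Finset.mem_range.1 hi).trans_le hdT)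
  rwa [Finset.card_range] at this

/-- The distilled policy competes with the optimal one at the price of coverage. The mixture may
include the policy of the current step, since a single record changes the mean squared error by at
most `4 R² / d`. -/
lemma distilled_le_cov (h : P.Admissible M COL c₀ 𝒞) (hrun : P.GoodRun M COL c₀ 𝒞 x π) {d d' : ℕ}
    (hd : 1 ≤ d) (hd1 : d' ≤ d + 1) (hd0 : d ≤ d') (hdT : d < P.T) {rmle : Reward S A}
    {πD : Policy S A} {rD : Reward S A} (hmle : P.IsMLE M x d rmle)
    (hrpo : P.IsRPO M x d πD rD) :
    M.relValue M.rstar (M.optPolicy M.rstar) - P.estDstl M x d rmle πD rD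
      ≤ 2 * (3 * P.c + 8) * 2 ^ c₀ * (M.R * Real.exp (2 * M.R)
        * M.cov (M.optPolicy M.rstar) (mix π d') * √(1 / (d' : ℝ) * P.logT ^ c₀)) := by
  have hR := h.one_le_R
  have hc := h.two_le_c
  have hmix := isPosPolicy_mix hrun (hd.trans hd0) (by omega : d' ≤ P.T)
  have hB := M.one_le_cov (M.isPosPolicy_optPolicy M.rstar).1 hmix
  have hdr : (0 : ℝ) < d := by exact_mod_cast hd
  have hd'r : (0 : ℝ) < d' := by exact_mod_cast hd.trans hd0
  refine (relValue_sub_estDstl_le h.good hR hc hd h.half_le_logT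
    (hrun.concentrated d hdT hd) hmle hrpo (subset_convexHull ℝ _ h.good.realizable) hB
    fun r hr => ?_).trans ?_
  · have hrI := M.mem_Icc_of_mem_rewardClass (by linarith) hr
    refine (M.pairExp_sq_le _ _ (M.isPosPolicy_optPolicy M.rstar).1 hmix.2 _).trans
      (mul_le_mul_of_nonneg_left ?_ (by linarith))
    have hmixe : M.pairExp (mix π d') (fun s a a' => M.prefErr r s a a' ^ 2)
        = 1 / (d' : ℝ) * ∑ i ∈ Finset.range d', M.sqErr r (π i) :=
      M.pairExp_sum_policy _ _ _ _
    rw [hmixe]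
    have h0 : ∀ i < P.T, 0 ≤ M.sqErr r (π i) :=
      fun i hi => M.sqErr_nonneg r (hrun.isPosPolicy i hi).1
    have hs : ∑ i ∈ Finset.range d', M.sqErr r (π i)
        ≤ ∑ i ∈ Finset.range d, M.sqErr r (π i) + 4 * M.R ^ 2 := by
      have h1 : ∑ i ∈ Finset.range d', M.sqErr r (π i)
          ≤ ∑ i ∈ Finset.range (d + 1), M.sqErr r (π i) :=
        Finset.sum_le_sum_of_subset_of_nonneg (Finset.range_mono hd1) fun i hi _ => h0 i (by
          have := Finset.mem_range.1 hi; omega)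
      rw [Finset.sum_range_succ] at h1
      linarith [M.sqErr_le hrI (hrun.isPosPolicy d hdT).1]
    have hs0 : 0 ≤ ∑ i ∈ Finset.range d', M.sqErr r (π i) :=
      Finset.sum_nonneg fun i hi => h0 i (by have := Finset.mem_range.1 hi; omega)
    calc 1 / (d' : ℝ) * ∑ i ∈ Finset.range d', M.sqErr r (π i)
        ≤ 1 / (d : ℝ) * ∑ i ∈ Finset.range d', M.sqErr r (π i) := by
          gcongr
      _ ≤ 1 / (d : ℝ) * (∑ i ∈ Finset.range d, M.sqErr r (π i) + 4 * M.R ^ 2) := by gcongr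
      _ = _ := by ring
  · have h1 := h.sqrt_radius_le hd hd1 hd0
    calc (3 * P.c + 8) * (M.R * Real.exp (2 * M.R)
          * M.cov (M.optPolicy M.rstar) (mix π d') * √(1 / (d : ℝ) * P.logT))
        ≤ (3 * P.c + 8) * (M.R * Real.exp (2 * M.R)
          * M.cov (M.optPolicy M.rstar) (mix π d')
            * (2 * 2 ^ c₀ * √(1 / (d' : ℝ) * P.logT ^ c₀))) := by gcongr
      _ = _ := by ring

/-- The distilled policy competes with the uniform mixture of the online policies, which is
well covered by the data because a fraction `α` of them is online, and which is nearly optimal by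
the no-regret guarantee. -/
lemma distilled_le_online (h : P.Admissible M COL c₀ 𝒞) (hrun : P.GoodRun M COL c₀ 𝒞 x π)
    {d d' : ℕ} (hd1 : d' ≤ d + 1) (hd0 : d ≤ d') (hdT : d < P.T)
    (htr : P.m ≤ d % P.N) {rmle : Reward S A} {πD : Policy S A} {rD : Reward S A}
    (hmle : P.IsMLE M x d rmle) (hrpo : P.IsRPO M x d πD rD) :
    M.relValue M.rstar (M.optPolicy M.rstar) - P.estDstl M x d rmle πD rD
      ≤ (2 * COL + 2 * (3 * P.c + 8) * 2 ^ c₀) * (M.R * Real.exp (2 * M.R)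
        * (√𝒞 / P.α) * √(1 / (d' : ℝ) * P.logT ^ c₀)) := by
  have hR := h.one_le_R
  have hc := h.two_le_c
  have h𝒞 := h.one_le_𝒞
  have hC0 := h.COL_pos
  have hα := α_pos h.m_pos h.m_lt
  have hα1 := α_le_one h.m_lt
  have hd : 1 ≤ d := by
    have := Nat.mod_le d P.N
    have := h.m_pos
    omega
  have hdr : (0 : ℝ) < d := by exact_mod_cast hd
  have hd'r : (0 : ℝ) < d' := by exact_mod_cast hd.trans hd0
  have hl := h.half_le_logT
  have hz : 0 ≤ P.logT ^ c₀ := Real.rpow_nonneg (by linarith) _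
  have hn1 : 1 ≤ P.onlineCount d := by
    have := h.m_pos
    simp only [onlineCount, min_eq_right htr]
    omega
  have hnr : (0 : ℝ) < P.onlineCount d := by exact_mod_cast hn1
  have hαn := α_mul_le_onlineCount h.m_lt d
  have hcard := card_onlineSteps h.m_lt d
  have hmem : ∀ i ∈ P.onlineSteps d, i < d ∧ i % P.N < P.m := fun i hi => by
    simpa [onlineSteps] using hi
  have hne : (P.onlineSteps d).Nonempty := by
    rw [← Finset.card_pos, hcard]; exact hn1
  set p : Policy S A := fun s a => 1 / ((P.onlineSteps d).card : ℝ) *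
    ∑ i ∈ P.onlineSteps d, π i s a with hp
  have hph : p ∈ Bandit.hull P.Pi := Bandit.average_mem_hull hne π fun i hi =>
    hrun.mem_hull i ((hmem i hi).1.trans hdT) (hmem i hi).2
  have hpp := h.good.isPosPolicy_of_mem_hull hph
  have hgap : M.gap p ≤ COL * (M.R * Real.exp (2 * M.R) * (√𝒞 / P.α)
      * √(1 / (d : ℝ) * P.logT ^ c₀)) := by
    have h1 := M.gap_average_le hne π fun i hi =>
      (hrun.isPosPolicy i ((hmem i hi).1.trans hdT)).1
    have h2 := h.online_le hrun hn1 hdT.le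
    have h3 : 1 / (P.onlineCount d : ℝ) * √(𝒞 * P.onlineCount d * P.logT ^ c₀)
        ≤ √𝒞 / P.α * √(1 / (d : ℝ) * P.logT ^ c₀) := by
      refine abs_le_of_sq_le_sq' ?_ (by positivity) |>.2
      rw [mul_pow, mul_pow (√𝒞 / P.α), div_pow (√𝒞), Real.sq_sqrt (by positivity),
        Real.sq_sqrt (by positivity),
        Real.sq_sqrt (by positivity)]
      have e1 : (1 / (P.onlineCount d : ℝ)) ^ 2 * (𝒞 * P.onlineCount d * P.logT ^ c₀)
          = 𝒞 * P.logT ^ c₀ * (1 / (P.onlineCount d : ℝ)) := by field_simp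
      have e2 : 𝒞 / P.α ^ 2 * (1 / (d : ℝ) * P.logT ^ c₀)
          = 𝒞 * P.logT ^ c₀ * (1 / (P.α ^ 2 * d)) := by field_simp
      rw [e1, e2]
      refine mul_le_mul_of_nonneg_left (one_div_le_one_div_of_le (by positivity) ?_)
        (by positivity)
      refine le_trans ?_ hαn
      have : P.α ^ 2 ≤ P.α := by nlinarith
      gcongr
    rw [← hp, hcard] at h1
    calc M.gap p ≤ 1 / (P.onlineCount d : ℝ) * ∑ i ∈ P.onlineSteps d, M.gap (π i) := h1
      _ ≤ 1 / (P.onlineCount d : ℝ) * (COL * M.R * Real.exp (2 * M.R)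
          * √(𝒞 * P.onlineCount d * P.logT ^ c₀)) := by gcongr
      _ = COL * M.R * Real.exp (2 * M.R)
          * (1 / (P.onlineCount d : ℝ) * √(𝒞 * P.onlineCount d * P.logT ^ c₀)) := by ring
      _ ≤ COL * M.R * Real.exp (2 * M.R)
          * (√𝒞 / P.α * √(1 / (d : ℝ) * P.logT ^ c₀)) := by gcongr
      _ = _ := by ring
  have hdd : √(1 / (d : ℝ) * P.logT ^ c₀) ≤ 2 * √(1 / (d' : ℝ) * P.logT ^ c₀) := by
    refine Real.sqrt_le_iff.2 ⟨by positivity, ?_⟩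
    rw [mul_pow, Real.sq_sqrt (by positivity)]
    have h1 : 1 / (d : ℝ) ≤ 2 ^ 2 * (1 / (d' : ℝ)) := by
      rw [mul_one_div, div_le_div_iff₀ hdr hd'r]
      have : (d' : ℝ) ≤ d + 1 := by exact_mod_cast hd1
      have : (1 : ℝ) ≤ d := by exact_mod_cast hd
      linarith
    rw [← mul_assoc]
    gcongr
  have hB : 1 ≤ 1 / P.α := (one_le_div hα).2 hα1
  have hdist := relValue_sub_estDstl_le h.good hR hc hd hl (hrun.concentrated d hdT hd) hmle hrpo
    hph hB (fun r hr => by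
      have hcs := M.pairExp_sq_le p p hpp.1 hpp.2 (M.prefErr r)
      rw [M.cov_self hpp, one_mul] at hcs
      refine hcs.trans ?_
      have he : M.pairExp p (fun s a a' => M.prefErr r s a a' ^ 2)
          = 1 / (P.onlineCount d : ℝ) * ∑ i ∈ P.onlineSteps d, M.sqErr r (π i) := by
        rw [← hcard]
        exact M.pairExp_sum_policy _ _ _ _
      have hsub : ∑ i ∈ P.onlineSteps d, M.sqErr r (π i)
          ≤ ∑ i ∈ Finset.range d, M.sqErr r (π i) :=
        Finset.sum_le_sum_of_subset_of_nonneg (Finset.filter_subset _ _) fun i hi _ =>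
          M.sqErr_nonneg r (hrun.isPosPolicy i ((Finset.mem_range.1 hi).trans hdT)).1
      have hs0 : 0 ≤ ∑ i ∈ Finset.range d, M.sqErr r (π i) :=
        Finset.sum_nonneg fun i hi =>
          M.sqErr_nonneg r (hrun.isPosPolicy i ((Finset.mem_range.1 hi).trans hdT)).1
      rw [he]
      calc 1 / (P.onlineCount d : ℝ) * ∑ i ∈ P.onlineSteps d, M.sqErr r (π i)
          ≤ 1 / (P.α * d) * ∑ i ∈ Finset.range d, M.sqErr r (π i) :=
            mul_le_mul (one_div_le_one_div_of_le (by positivity) hαn) hsub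
              (Finset.sum_nonneg fun i hi => M.sqErr_nonneg r
                (hrun.isPosPolicy i ((hmem i hi).1.trans hdT)).1) (by positivity)
        _ = 1 / P.α * (1 / (d : ℝ) * ∑ i ∈ Finset.range d, M.sqErr r (π i)) := by
            field_simp
        _ ≤ _ := by
            refine mul_le_mul_of_nonneg_left ?_ (by positivity)
            have : 0 ≤ 4 * M.R ^ 2 / (d : ℝ) := by positivity
            linarith)
  have hrad := h.sqrt_radius_le hd hd1 hd0
  have h𝒞1 : 1 / P.α ≤ √𝒞 / P.α := by
    gcongr
    exact Real.one_le_sqrt.2 h𝒞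
  have hq : (0 : ℝ) < 2 ^ c₀ := by positivity
  have hsecond : (3 * P.c + 8) * (M.R * Real.exp (2 * M.R) * (1 / P.α) * √(1 / (d : ℝ) * P.logT))
      ≤ 2 * (3 * P.c + 8) * 2 ^ c₀ * (M.R * Real.exp (2 * M.R) * (√𝒞 / P.α)
        * √(1 / (d' : ℝ) * P.logT ^ c₀)) := by
    calc (3 * P.c + 8) * (M.R * Real.exp (2 * M.R) * (1 / P.α) * √(1 / (d : ℝ) * P.logT))
        ≤ (3 * P.c + 8) * (M.R * Real.exp (2 * M.R) * (√𝒞 / P.α)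
          * (2 * 2 ^ c₀ * √(1 / (d' : ℝ) * P.logT ^ c₀))) := by gcongr
      _ = _ := by ring
  have hfirst : COL * (M.R * Real.exp (2 * M.R) * (√𝒞 / P.α) * √(1 / (d : ℝ) * P.logT ^ c₀))
      ≤ 2 * COL * (M.R * Real.exp (2 * M.R) * (√𝒞 / P.α)
        * √(1 / (d' : ℝ) * P.logT ^ c₀)) := by
    calc COL * (M.R * Real.exp (2 * M.R) * (√𝒞 / P.α) * √(1 / (d : ℝ) * P.logT ^ c₀))
        ≤ COL * (M.R * Real.exp (2 * M.R) * (√𝒞 / P.α)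
          * (2 * √(1 / (d' : ℝ) * P.logT ^ c₀))) := by gcongr
      _ = _ := by ring
  rw [M.gap_eq_relValue] at hgap
  linarith

lemma iota_nonneg (h : P.Admissible M COL c₀ 𝒞) (hrun : P.GoodRun M COL c₀ 𝒞 x π) {d : ℕ}
    (hd : 1 ≤ d) (hdT : d ≤ P.T) {C : ℝ} (hC : 0 ≤ C) : 0 ≤ P.iota M C c₀ 𝒞 π d := by
  have hR := h.one_le_R
  have hα := α_pos h.m_pos h.m_lt
  have hcov := M.one_le_cov (M.isPosPolicy_optPolicy M.rstar).1 (isPosPolicy_mix hrun hd hdT)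
  have hmin : 0 ≤ min (M.cov (M.optPolicy M.rstar) (mix π d)) (√𝒞 / P.α) :=
    le_min (by linarith) (by positivity)
  unfold iota
  positivity

lemma distilled_le_iota (h : P.Admissible M COL c₀ 𝒞) (hrun : P.GoodRun M COL c₀ 𝒞 x π)
    {d d' : ℕ} (hd1 : d' ≤ d + 1) (hd0 : d ≤ d') (hdT : d < P.T)
    (htr : P.m ≤ d % P.N) {rmle : Reward S A} {πD : Policy S A} {rD : Reward S A}
    (hmle : P.IsMLE M x d rmle) (hrpo : P.IsRPO M x d πD rD) :
    M.relValue M.rstar (M.optPolicy M.rstar) - P.estDstl M x d rmle πD rD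
      ≤ P.iota M (regretConst COL c₀ P.c) c₀ 𝒞 π d' := by
  have hd : 1 ≤ d := by
    have := Nat.mod_le d P.N
    have := h.m_pos
    omega
  have hR := h.one_le_R
  have hc := h.two_le_c
  have hC0 := h.COL_pos
  have hα := α_pos h.m_pos h.m_lt
  have hcov := M.one_le_cov (M.isPosPolicy_optPolicy M.rstar).1
    (isPosPolicy_mix hrun (hd.trans hd0) (by omega : d' ≤ P.T))
  have h1 := h.distilled_le_cov hrun hd hd1 hd0 hdT hmle hrpo
  have h2 := h.distilled_le_online hrun hd1 hd0 hdT htr hmle hrpo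
  have hq : (0 : ℝ) < 2 ^ c₀ := by positivity
  have hK : 0 < (3 * P.c + 8) * 2 ^ c₀ := by positivity
  unfold iota
  rcases min_choice (M.cov (M.optPolicy M.rstar) (mix π d')) (√𝒞 / P.α) with hm | hm <;> rw [hm]
  · refine h1.trans (mul_le_mul_of_nonneg_right ?_ (by positivity))
    unfold regretConst
    linarith
  · refine h2.trans (mul_le_mul_of_nonneg_right ?_ (by positivity))
    unfold regretConst
    linarith

/-- The transfer part of the regret, for mixtures that include (`e = 1`) or do not include
(`e = 0`) the policy of the current step. -/
lemma transfer_regret_le (h : P.Admissible M COL c₀ 𝒞) (hrun : P.GoodRun M COL c₀ 𝒞 x π) {t : ℕ}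
    (ht : t ≤ P.T) {e : ℕ} (he : e ≤ 1) :
    ∑ i ∈ P.transferSteps t, M.gap (π i) ≤ regretConst COL c₀ P.c *
      (∑ i ∈ P.transferSteps t, P.capΔ M (P.iota M (regretConst COL c₀ P.c) c₀ 𝒞 π (i + e))
        + P.explore M t) := by
  classical
  have hR := h.one_le_R
  have hc := h.two_le_c
  have hl := h.half_le_logT
  have hC0 := h.COL_pos
  have hq : (0 : ℝ) < 2 ^ c₀ := by positivity
  set C := regretConst COL c₀ P.c with hCdef
  have hC : 16384 ≤ C := by
    have : 0 < 2 * (3 * P.c + 8) * 2 ^ c₀ := by positivity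
    simp only [hCdef, regretConst]
    linarith
  set X : ℕ → ℝ := fun i => P.capΔ M (P.iota M C c₀ 𝒞 π (i + e)) with hX
  set b : ℝ := 64 * Real.exp (2 * M.R) * √P.logWT with hb
  set F := P.transferSteps t with hF
  have hmem : ∀ i ∈ F, i < t ∧ P.m ≤ i % P.N := fun i hi => by
    simpa [hF, transferSteps] using hi
  have hpos1 : ∀ i ∈ F, 1 ≤ i := fun i hi => by
    have := (hmem i hi).2
    have := Nat.mod_le i P.N
    have := h.m_pos
    omega
  have hι : ∀ i ∈ F, 0 ≤ P.iota M C c₀ 𝒞 π (i + e) := fun i hi =>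
    h.iota_nonneg hrun (by have := hpos1 i hi; omega)
      (by have := (hmem i hi).1; omega) (by linarith)
  have hX0 : ∀ i ∈ F, 0 ≤ X i := fun i hi => le_capΔ (hι i hi) Δ_nonneg
  have hstep : ∀ i ∈ F, M.gap (π i) ≤ X i ∨ ∃ j, π i = M.optPolicy (P.src j) ∧
      M.gap (π i) = P.Δ M j ∧ M.gap (π i) ≤ X i + b / √((P.visits M π i j : ℝ) + 1) := by
    intro i hi
    have hiT := (hmem i hi).1.trans_le ht
    rcases IsTPS.gap_le h.good hR hc (hpos1 i hi) hl h.logT_le_logWT h.src_mem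
      (fun j hj => (hrun.isPosPolicy j (hj.trans hiT)).1)
      (hrun.concentrated i hiT (hpos1 i hi)) (hrun.isTPS i hiT (hmem i hi).2) (hι i hi)
      (fun rmle πD rD hmle hrpo => h.distilled_le_iota hrun (by omega) (by omega) hiT
        (hmem i hi).2 hmle hrpo) with h1 | ⟨j, hj, h1⟩
    · exact Or.inl h1
    · exact Or.inr ⟨j, hj, by rw [hj]; rfl, h1⟩
  have hvis : ∀ j, ∀ i ∈ F, ∀ i' ∈ F, π i = M.optPolicy (P.src j) → i < i' →
      P.visits M π i j < P.visits M π i' j := by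
    intro j i _ i' _ hsel hii
    refine Finset.card_lt_card (Finset.ssubset_iff_of_subset ?_ |>.2 ⟨i, ?_, ?_⟩)
    · intro k hk
      rw [Finset.mem_filter, Finset.mem_range] at hk ⊢
      exact ⟨hk.1.trans hii, hk.2⟩
    · exact Finset.mem_filter.2 ⟨Finset.mem_range.2 hii, hsel⟩
    · simp
  have hb0 : 0 ≤ b := by positivity
  have hsum1 := sum_le_add_sqrt hb0 hstep hvis
  have hsum2 := sum_le_add_inv_gap hX0 (fun j => Δ_nonneg (M := M) j) hstep hvis
  have hXs : 0 ≤ ∑ i ∈ F, X i := Finset.sum_nonneg hX0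
  have hCX : 2 * ∑ i ∈ F, X i ≤ C * ∑ i ∈ F, X i :=
    mul_le_mul_of_nonneg_right (by linarith) hXs
  rw [mul_add]
  unfold explore
  rcases min_choice (Real.exp (2 * M.R) * √((1 - P.α) * P.W * t * P.logWT))
    (∑ i ∈ Finset.univ.filter (fun i : Fin P.W => 0 < P.Δ M i),
      Real.exp (4 * M.R) / P.Δ M i * P.logWT) with hm | hm <;> rw [hm]
  · have hcard := card_transferSteps_le h.m_lt t
    have h1 : 2 * b * √((P.W : ℝ) * F.card)
        ≤ C * (Real.exp (2 * M.R) * √((1 - P.α) * P.W * t * P.logWT)) := by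
      rcases Nat.eq_zero_or_pos P.W with hW | hW
      · simp [hW]
      have hLW := h.logT_le_logWT hW
      have h2 : √P.logWT * √((P.W : ℝ) * F.card) ≤ √((1 - P.α) * P.W * t * P.logWT) := by
        rw [← Real.sqrt_mul (by linarith)]
        refine Real.sqrt_le_sqrt ?_
        have h0 : 0 ≤ P.logWT * P.W := mul_nonneg (by linarith) (Nat.cast_nonneg _)
        nlinarith [mul_le_mul_of_nonneg_left hcard h0]
      calc 2 * b * √((P.W : ℝ) * F.card)
          = 128 * (Real.exp (2 * M.R) * (√P.logWT * √((P.W : ℝ) * F.card))) := by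
            rw [hb]; ring
        _ ≤ C * (Real.exp (2 * M.R) * √((1 - P.α) * P.W * t * P.logWT)) := by
            gcongr
            linarith
    linarith
  · have h1 : ∑ j with 0 < P.Δ M j, 4 * b ^ 2 / P.Δ M j
        ≤ C * ∑ i ∈ Finset.univ.filter (fun i : Fin P.W => 0 < P.Δ M i),
          Real.exp (4 * M.R) / P.Δ M i * P.logWT := by
      rw [Finset.mul_sum]
      refine Finset.sum_le_sum fun j hj => ?_
      have hj := (Finset.mem_filter.1 hj).2
      have hLW := h.logT_le_logWT (Fin.pos j)
      have hL0 : 0 ≤ P.logWT := by linarith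
      have hE : Real.exp (2 * M.R) ^ 2 = Real.exp (4 * M.R) := by
        rw [← Real.exp_nat_mul]; ring_nf
      have h2 : 4 * b ^ 2 / P.Δ M j = 16384 * (Real.exp (4 * M.R) / P.Δ M j * P.logWT) := by
        rw [hb, mul_pow, mul_pow, Real.sq_sqrt hL0, hE]
        ring
      rw [h2]
      gcongr
    linarith

end Admissible

end Config

/-! ### Concentration of the log-likelihood along the interaction -/

lemma IsInteraction.monotone_past {S : Type u} {A : Type v} [Fintype S] [Fintype A]
    [MeasurableSpace S] [MeasurableSpace A] {Ω : Type w} [MeasurableSpace Ω] {M : Bandit S A}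
    {n : ℕ} {μ : Measure Ω} {ℋ 𝒢 : ℕ → MeasurableSpace Ω} {π : ℕ → Ω → Policy S A}
    {x : ℕ → Ω → Outcome S A} (h : IsInteraction M n μ ℋ 𝒢 π x) : Monotone ℋ :=
  monotone_nat_of_le_succ fun i => (h.le_choice i).trans (h.le_next i)

namespace IsInteraction

variable {S : Type u} {A : Type v} [Fintype S] [Fintype A]
  [MeasurableSpace S] [MeasurableSingletonClass S] [MeasurableSpace A] [MeasurableSingletonClass A]
  {Ω : Type w} [mΩ : MeasurableSpace Ω] {M : Bandit S A} {n : ℕ} {μ : Measure Ω}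
  [IsProbabilityMeasure μ] {ℋ 𝒢 : ℕ → MeasurableSpace Ω} {π : ℕ → Ω → Policy S A}
  {x : ℕ → Ω → Outcome S A}

/-- Integrating out the comparison of step `i`. -/
lemma integral_mul_outcome (h : IsInteraction M n μ ℋ 𝒢 π x) {i : ℕ} (hi : i < n)
    (f : Outcome S A → ℝ) {Z : Ω → ℝ} (hZ : Measurable[𝒢 i] Z) {b : ℝ}
    (hb : ∀ᵐ ω ∂μ, ‖Z ω‖ ≤ b) :
    ∫ ω, Z ω * f (x i ω) ∂μ = ∫ ω, Z ω * ∑ z, f z * M.outcomeProb (π i ω) z ∂μ := by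
  classical
  have h𝒢 : 𝒢 i ≤ mΩ := (h.le_next i).trans (h.le_ambient _)
  have hx : Measurable (x i) := (h.measurable_outcome i hi).mono (h.le_ambient _) le_rfl
  have hZm : AEStronglyMeasurable Z μ := (hZ.mono h𝒢 le_rfl).aestronglyMeasurable
  set I : Outcome S A → Ω → ℝ := fun z => (x i ⁻¹' {z}).indicator fun _ => (1 : ℝ) with hI
  have hIint : ∀ z, Integrable (I z) μ := fun z =>
    (integrable_const (1 : ℝ)).indicator (hx (measurableSet_singleton z))
  have hcond : ∀ z, μ[Z * I z | 𝒢 i] =ᵐ[μ] fun ω => Z ω * M.outcomeProb (π i ω) z := by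
    intro z
    have h1 := condExp_stronglyMeasurable_mul_of_bound h𝒢 hZ.stronglyMeasurable (hIint z) b hb
    filter_upwards [h1, h.outcome_law i hi z] with ω h2 h3
    rw [h2, Pi.mul_apply]
    congr 1
  have hint1 : ∀ z, Integrable (Z * I z) μ := fun z => (hIint z).bdd_mul hZm hb
  have hint2 : ∀ z, Integrable (fun ω => Z ω * M.outcomeProb (π i ω) z) μ := fun z =>
    integrable_condExp.congr (hcond z)
  have hsum : ∀ ω, Z ω * f (x i ω) = ∑ z, f z * (Z * I z) ω := by
    intro ω
    rw [Finset.sum_eq_single (x i ω)]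
    · simp [hI, mul_comm]
    · intro z _ hz
      have : ω ∉ x i ⁻¹' {z} := fun h => hz (by simpa using h.symm)
      simp [hI, Set.indicator_of_notMem this]
    · simp
  have hsum2 : ∀ ω, Z ω * ∑ z, f z * M.outcomeProb (π i ω) z
      = ∑ z, f z * (Z ω * M.outcomeProb (π i ω) z) := by
    intro ω
    rw [Finset.mul_sum]
    exact Finset.sum_congr rfl fun z _ => by ring
  simp only [hsum, hsum2]
  rw [integral_finsetSum _ fun z _ => (hint1 z).const_mul _,
    integral_finsetSum _ fun z _ => (hint2 z).const_mul _]
  refine Finset.sum_congr rfl fun z _ => ?_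
  rw [integral_const_mul, integral_const_mul, ← integral_condExp h𝒢, integral_congr_ae (hcond z)]

/-- The product of `f(xⱼ) e^{G(πⱼ)}` over the first `d` steps. -/
noncomputable def likelihoodProd (f : Outcome S A → ℝ) (G : Policy S A → ℝ)
    (π : ℕ → Ω → Policy S A) (x : ℕ → Ω → Outcome S A) (d : ℕ) (ω : Ω) : ℝ :=
  ∏ j ∈ Finset.range d, (f (x j ω) * Real.exp (G (π j ω)))

/-- If `f` has conditional mean at most `e^{-G}`, the product is a nonnegative supermartingale
started at one; measurability, boundedness, and the bound on the mean are proved together. -/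
lemma integral_likelihoodProd_le (h : IsInteraction M n μ ℋ 𝒢 π x)
    (hπ : ∀ i < n, ∀ᵐ ω ∂μ, IsPolicy (π i ω)) {f : Outcome S A → ℝ} (hf : ∀ z, 0 ≤ f z)
    {G : Policy S A → ℝ} (hG : Measurable G) {b : ℝ} (hGb : ∀ p, IsPolicy p → G p ≤ b)
    (hfG : ∀ p, IsPolicy p → ∑ z, f z * M.outcomeProb p z ≤ Real.exp (-G p)) {d : ℕ}
    (hd : d ≤ n) :
    Measurable[ℋ d] (likelihoodProd f G π x d) ∧
      (∃ c, ∀ᵐ ω ∂μ, ‖likelihoodProd f G π x d ω‖ ≤ c) ∧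
      ∫ ω, likelihoodProd f G π x d ω ∂μ ≤ 1 := by
  have hfm : Measurable f := measurable_of_finite f
  induction d with
  | zero =>
    refine ⟨?_, ⟨1, ?_⟩, ?_⟩
    · have : likelihoodProd f G π x 0 = fun _ => (1 : ℝ) := by funext ω; simp [likelihoodProd]
      rw [this]
      exact measurable_const
    · simp [likelihoodProd]
    · simp [likelihoodProd]
  | succ d ih =>
    have hdn : d < n := hd
    obtain ⟨hm, ⟨c, hc⟩, hint⟩ := ih hdn.le
    have hsucc : ∀ ω, likelihoodProd f G π x (d + 1) ω
        = (likelihoodProd f G π x d ω * Real.exp (G (π d ω))) * f (x d ω) := by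
      intro ω
      simp only [likelihoodProd, Finset.prod_range_succ]
      ring
    have hZ : Measurable[𝒢 d] fun ω => likelihoodProd f G π x d ω * Real.exp (G (π d ω)) :=
      (hm.mono (h.le_choice d) le_rfl).mul
        (Real.measurable_exp.comp (hG.comp (h.measurable_policy d hdn)))
    have hnn : ∀ ω, 0 ≤ likelihoodProd f G π x d ω := fun ω =>
      Finset.prod_nonneg fun j _ => mul_nonneg (hf _) (Real.exp_pos _).le
    have hZb : ∀ᵐ ω ∂μ, ‖likelihoodProd f G π x d ω * Real.exp (G (π d ω))‖ ≤ c * Real.exp b := by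
      filter_upwards [hc, hπ d hdn] with ω h1 h2
      rw [norm_mul, Real.norm_of_nonneg (Real.exp_pos _).le]
      exact mul_le_mul h1 (Real.exp_le_exp.2 (hGb _ h2)) (Real.exp_pos _).le
        ((norm_nonneg _).trans h1)
    have h𝒢 : 𝒢 d ≤ mΩ := (h.le_next d).trans (h.le_ambient _)
    refine ⟨?_, ⟨c * Real.exp b * ∑ z, f z, ?_⟩, ?_⟩
    · have : likelihoodProd f G π x (d + 1) = fun ω =>
          (likelihoodProd f G π x d ω * Real.exp (G (π d ω))) * f (x d ω) := funext hsucc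
      rw [this]
      exact (hZ.mono (h.le_next d) le_rfl).mul (hfm.comp (h.measurable_outcome d hdn))
    · filter_upwards [hZb] with ω h1
      rw [hsucc, norm_mul, Real.norm_of_nonneg (hf (x d ω))]
      exact mul_le_mul h1 (Finset.single_le_sum (fun z _ => hf z) (Finset.mem_univ _))
        (hf _) ((norm_nonneg _).trans h1)
    · simp only [hsucc]
      rw [h.integral_mul_outcome hdn f hZ hZb]
      refine le_trans (integral_mono_of_nonneg ?_ ?_ ?_) hint
      · filter_upwards [hπ d hdn] with ω h1
        refine mul_nonneg (mul_nonneg (hnn ω) (Real.exp_pos _).le)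
          (Finset.sum_nonneg fun z _ => mul_nonneg (hf z) ?_)
        exact mul_nonneg (mul_nonneg (mul_nonneg (M.ρ_nonneg _) (h1.1 _ _)) (M.πref_pos _ _).le)
          (Bandit.btProb_pos _ _).le
      · exact Integrable.of_bound
          (hm.mono (h.le_ambient d) le_rfl).aestronglyMeasurable c hc
      · filter_upwards [hπ d hdn] with ω h1
        calc likelihoodProd f G π x d ω * Real.exp (G (π d ω))
              * ∑ z, f z * M.outcomeProb (π d ω) z
            ≤ likelihoodProd f G π x d ω * Real.exp (G (π d ω)) * Real.exp (-G (π d ω)) :=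
              mul_le_mul_of_nonneg_left (hfG _ h1) (mul_nonneg (hnn ω) (Real.exp_pos _).le)
          _ = likelihoodProd f G π x d ω := by
              rw [mul_assoc, ← Real.exp_add, add_neg_cancel, Real.exp_zero, mul_one]

/-- Markov's inequality for the exponential supermartingale of one reward at one time. -/
lemma measure_not_concentrated_le (h : IsInteraction M n μ ℋ 𝒢 π x)
    (hπ : ∀ i < n, ∀ᵐ ω ∂μ, IsPolicy (π i ω)) {r : Reward S A}
    (hr : ∀ s a, r s a ∈ Set.Icc 0 M.R) {d : ℕ} (hd1 : 1 ≤ d) (hd : d ≤ n) (l : ℝ) :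
    μ.real {ω | 2 * l < d * (nll (fun j => x j ω) d M.rstar - nll (fun j => x j ω) d r)
      + minSlope M.R ^ 2 * ∑ i ∈ Finset.range d, M.sqErr r (π i ω)} ≤ Real.exp (-l) := by
  set f : Outcome S A → ℝ := fun z => √(Bandit.btProb r z / Bandit.btProb M.rstar z) with hf
  set G : Policy S A → ℝ := fun p => minSlope M.R ^ 2 / 2 * M.sqErr r p with hG
  have hGm : Measurable G := by
    simp only [hG, Bandit.sqErr, Bandit.pairExp]
    fun_prop
  obtain ⟨hm, ⟨c, hc⟩, hint⟩ := h.integral_likelihoodProd_le hπ (f := f)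
    (fun z => Real.sqrt_nonneg _) hGm (b := minSlope M.R ^ 2 / 2 * (4 * M.R ^ 2))
    (fun p hp => mul_le_mul_of_nonneg_left (M.sqErr_le hr hp) (by positivity))
    (fun p hp => (M.sum_sqrt_ratio_mul_outcomeProb_le hr hp).trans (by
      have := Real.add_one_le_exp (-G p)
      simp only [hG] at this ⊢
      linarith)) hd
  have hexp : ∀ ω, likelihoodProd f G π x d ω
      = Real.exp ((d * (nll (fun j => x j ω) d M.rstar - nll (fun j => x j ω) d r)
        + minSlope M.R ^ 2 * ∑ i ∈ Finset.range d, M.sqErr r (π i ω)) / 2) := by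
    intro ω
    have hd0 : (d : ℝ) ≠ 0 := by
      have : (0 : ℝ) < d := by exact_mod_cast hd1
      exact this.ne'
    have hfe : ∀ z, f z
        = Real.exp ((Real.log (Bandit.btProb r z) - Real.log (Bandit.btProb M.rstar z)) / 2) := by
      intro z
      have h1 := Bandit.btProb_pos r z
      have h2 := Bandit.btProb_pos M.rstar z
      rw [← Real.log_div h1.ne' h2.ne', ← Real.log_sqrt (by positivity),
        Real.exp_log (by positivity)]
    simp only [likelihoodProd, hfe, ← Real.exp_add, ← Real.exp_sum, hG]
    congr 1
    rw [mul_sub]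
    simp only [nll]
    rw [← mul_assoc, ← mul_assoc, mul_one_div_cancel hd0, one_mul, one_mul,
      ← Finset.sum_sub_distrib, Finset.mul_sum, ← Finset.sum_add_distrib, Finset.sum_div]
    refine Finset.sum_congr rfl fun i _ => ?_
    ring
  have hnn : 0 ≤ᵐ[μ] likelihoodProd f G π x d := by
    filter_upwards with ω
    rw [hexp]
    exact (Real.exp_pos _).le
  have hInt : Integrable (likelihoodProd f G π x d) μ :=
    Integrable.of_bound (hm.mono (h.le_ambient d) le_rfl).aestronglyMeasurable c hc
  have hmarkov := mul_meas_ge_le_integral_of_nonneg hnn hInt (Real.exp l)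
  have hsub : {ω | 2 * l < d * (nll (fun j => x j ω) d M.rstar - nll (fun j => x j ω) d r)
      + minSlope M.R ^ 2 * ∑ i ∈ Finset.range d, M.sqErr r (π i ω)}
      ⊆ {ω | Real.exp l ≤ likelihoodProd f G π x d ω} := by
    intro ω hω
    rw [Set.mem_ofPred_eq] at hω ⊢
    rw [hexp]
    exact Real.exp_le_exp.2 (by linarith)
  refine (measureReal_mono hsub).trans ?_
  rw [Real.exp_neg, ← one_div, le_div_iff₀ (Real.exp_pos _), mul_comm]
  exact hmarkov.trans hint

/-- With probability at least `1 - δ`, the maximum likelihood event holds at all times. -/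
lemma measure_exists_not_concentrated_le {P : Config S A} {COL c₀ 𝒞 : ℝ}
    (hP : P.Admissible M COL c₀ 𝒞) (h : IsInteraction M P.T μ ℋ 𝒢 π x)
    (hπ : ∀ i < P.T, ∀ᵐ ω ∂μ, IsPolicy (π i ω)) :
    μ.real {ω | ¬ ∀ d < P.T, 1 ≤ d →
      P.Concentrated M (fun j => x j ω) (fun j => π j ω) d} ≤ P.δ := by
  classical
  set bad : ℕ × Policy S A → Set Ω := fun q =>
    {ω | 2 * P.logT < q.1 * (nll (fun j => x j ω) q.1 M.rstar
        - nll (fun j => x j ω) q.1 (M.rewardOf q.2))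
      + minSlope M.R ^ 2 * ∑ i ∈ Finset.range q.1, M.sqErr (M.rewardOf q.2) (π i ω)} with hbad
  have hsub : {ω | ¬ ∀ d < P.T, 1 ≤ d → P.Concentrated M (fun j => x j ω) (fun j => π j ω) d}
      ⊆ ⋃ q ∈ (Finset.Ico 1 P.T) ×ˢ P.Pi, bad q := by
    intro ω hω
    simp only [Set.mem_ofPred_eq, not_forall, Config.Concentrated] at hω
    obtain ⟨d, hdT, hd1, r, ⟨p, hp, rfl⟩, hlt⟩ := hω
    refine Set.mem_biUnion (x := (d, p)) ?_ (not_le.1 hlt)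
    exact Finset.mem_coe.2 (Finset.mem_product.2 ⟨Finset.mem_Ico.2 ⟨hd1, hdT⟩, hp⟩)
  have hcard : (0 : ℝ) < P.Pi.card := by exact_mod_cast hP.nonempty.card_pos
  have hT : (0 : ℝ) < P.T := by exact_mod_cast (by have := hP.two_le_T; omega : 0 < P.T)
  have hexp : Real.exp (-P.logT) = P.δ / ((P.Pi.card : ℝ) * P.T) := by
    have := hP.δ_pos
    rw [Real.exp_neg, Config.logT, Real.exp_log (by positivity), inv_div]
  calc _ ≤ μ.real (⋃ q ∈ (Finset.Ico 1 P.T) ×ˢ P.Pi, bad q) :=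
        measureReal_mono hsub (measure_ne_top _ _)
    _ ≤ ∑ q ∈ (Finset.Ico 1 P.T) ×ˢ P.Pi, μ.real (bad q) := measureReal_biUnion_finset_le _ _
    _ ≤ ∑ q ∈ (Finset.Ico 1 P.T) ×ˢ P.Pi, Real.exp (-P.logT) := by
        refine Finset.sum_le_sum fun q hq => ?_
        obtain ⟨h1, -⟩ := Finset.mem_product.1 hq
        obtain ⟨h2, h3⟩ := Finset.mem_Ico.1 h1
        exact h.measure_not_concentrated_le hπ
          (M.rewardOf_mem_Icc (by linarith [hP.one_le_R]) q.2) h2 h3.le _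
    _ = (P.T - 1 : ℕ) * P.Pi.card * (P.δ / ((P.Pi.card : ℝ) * P.T)) := by
        rw [Finset.sum_const, nsmul_eq_mul, Finset.card_product, Nat.card_Ico, hexp]
        push_cast
        ring
    _ ≤ P.T * P.Pi.card * (P.δ / ((P.Pi.card : ℝ) * P.T)) := by
        have := hP.δ_pos
        gcongr
        exact Nat.sub_le _ _
    _ = P.δ := by field_simp

end IsInteraction

/-! ### The online learner inside the run -/

section Online

variable {S : Type u} {A : Type v} [Fintype S] [Fintype A] [MeasurableSpace S] [MeasurableSpace A]
  {Ω : Type w} [mΩ : MeasurableSpace Ω] {M : Bandit S A} {μ : Measure Ω}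
  {ℋ 𝒢 : ℕ → MeasurableSpace Ω} {π : ℕ → Ω → Policy S A} {x : ℕ → Ω → Outcome S A}

lemma measurableSet_hull {S : Type u} {A : Type v} [Fintype S] [Fintype A]
    (Pi : Finset (Policy S A)) : MeasurableSet (Bandit.hull Pi) :=
  (Pi.finite_toSet.isCompact_convexHull ℝ).isClosed.measurableSet

/-- A policy whose conditional law is carried by the hull lies in the hull almost surely. -/
lemma OnlineAlg.Runs.ae_mem_hull [IsProbabilityMeasure μ] {Pi : Finset (Policy S A)}
    {alg : OnlineAlg Pi} {n : ℕ} (h : alg.Runs n μ ℋ π x) {j : ℕ} (hj : j < n)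
    (hℋ : ℋ j ≤ mΩ) (hπ : Measurable (π j)) : ∀ᵐ ω ∂μ, π j ω ∈ Bandit.hull Pi := by
  have hB := measurableSet_hull Pi
  have hlaw := h j hj _ hB
  have hone : ∀ y, (alg.next j y).real (Bandit.hull Pi) = 1 := by
    intro y
    have := alg.markov j
    rw [measureReal_def, (mem_ae_iff_prob_eq_one hB).1 (alg.mem_hull j y), ENNReal.toReal_one]
  have hint : μ.real (π j ⁻¹' Bandit.hull Pi) = 1 := by
    calc μ.real (π j ⁻¹' Bandit.hull Pi)
        = ∫ ω, (π j ⁻¹' Bandit.hull Pi).indicator (fun _ => (1 : ℝ)) ω ∂μ := by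
          rw [integral_indicator (hπ hB)]; simp
      _ = ∫ ω, (μ⟦π j ⁻¹' Bandit.hull Pi | ℋ j⟧) ω ∂μ := (integral_condExp hℋ).symm
      _ = ∫ _, (1 : ℝ) ∂μ := integral_congr_ae (by
          filter_upwards [hlaw] with ω hω
          rw [hω, hone])
      _ = 1 := by simp
  refine (mem_ae_iff_prob_eq_one (hπ hB)).2 ?_
  rwa [measureReal_def, ENNReal.toReal_eq_one_iff] at hint

/-- The online iterations of a run, taken by themselves, are an interaction. -/
lemma IsInteraction.online {P : Config S A} (h : IsInteraction M P.T μ ℋ 𝒢 π x)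
    (hm : 0 < P.m) (hN : P.m < P.N) :
    IsInteraction M (P.K * P.m) μ (fun j => ℋ (P.onlineTime j)) (fun j => 𝒢 (P.onlineTime j))
      (fun j => π (P.onlineTime j)) (fun j => x (P.onlineTime j)) where
  le_choice _ := h.le_choice _
  le_next j := (h.le_next _).trans
    (h.monotone_past (Nat.succ_le_of_lt (Config.onlineTime_lt_succ hm hN j)))
  le_ambient _ := h.le_ambient _
  measurable_policy _ hj := h.measurable_policy _ (Config.onlineTime_lt_T hm hN hj)
  measurable_outcome j hj := (h.measurable_outcome _ (Config.onlineTime_lt_T hm hN hj)).mono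
    (h.monotone_past (Nat.succ_le_of_lt (Config.onlineTime_lt_succ hm hN j))) le_rfl
  outcome_law _ hj := h.outcome_law _ (Config.onlineTime_lt_T hm hN hj)

/-- Almost surely, all policies of a run have full support, those of the online iterations lie in
the hull, and those of the transfer iterations come from transfer policy selection. -/
lemma IsTPORun.ae_properties [IsProbabilityMeasure μ] {P : Config S A} {alg : OnlineAlg P.Pi}
    {COL c₀ 𝒞 : ℝ} (hP : P.Admissible M COL c₀ 𝒞) (h : IsTPORun M P alg μ ℋ 𝒢 π x) :
    ∀ i < P.T, ∀ᵐ ω ∂μ, Bandit.IsPosPolicy (π i ω) ∧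
      (i % P.N < P.m → π i ω ∈ Bandit.hull P.Pi) ∧
      (P.m ≤ i % P.N → P.IsTPS M (fun j => x j ω) (fun j => π j ω) i (π i ω)) := by
  intro i hi
  rcases lt_or_ge (i % P.N) P.m with hon | htr
  · have htime := Config.onlineTime_onlineCount hon
    have hcount : P.onlineCount i < P.K * P.m := by
      have h1 := Config.onlineCount_le (Nat.succ_le_of_lt hi)
      rw [Nat.succ_eq_add_one, Config.onlineCount_succ hP.m_lt, if_pos hon] at h1
      omega
    have hmeas : Measurable (π (P.onlineTime (P.onlineCount i))) :=
      (h.interaction.measurable_policy _ (by rw [htime]; exact hi)).mono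
        ((h.interaction.le_next _).trans (h.interaction.le_ambient _)) le_rfl
    have hmem := h.online.ae_mem_hull hcount (h.interaction.le_ambient _) hmeas
    rw [htime] at hmem
    filter_upwards [hmem] with ω hω
    exact ⟨hP.good.isPosPolicy_of_mem_hull hω, fun _ => hω, fun h => absurd hon (not_lt.2 h)⟩
  · filter_upwards [h.transfer i hi htr] with ω hω
    exact ⟨hω.isPosPolicy hP.good, fun h => absurd htr (not_le.2 h), fun _ => hω⟩

end Online

end RLHF

theorem mainTheorem1 (COL c₀ c : ℝ) (hCOL : 0 < COL) (hc₀ : 1 ≤ c₀) (hc : 2 ≤ c) :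
    ∃ C : ℝ, 0 < C ∧
      ∀ (S : Type u) (A : Type v) [Fintype S] [Fintype A]
        [MeasurableSpace S] [MeasurableSingletonClass S]
        [MeasurableSpace A] [MeasurableSingletonClass A]
        (M : RLHF.Bandit S A) (P : RLHF.Config S A) (𝒞 : ℝ) (alg : RLHF.OnlineAlg P.Pi),
        1 ≤ M.R → 1 ≤ 𝒞 → M.GoodClass P.Pi →
        (∀ i s a, P.src i s a ∈ Set.Icc 0 M.R) →
        0 < P.m → P.m < P.N → 0 < P.K → 0 < P.δ → P.δ < 1 → P.c = c →
        RLHF.OnlineAlg.NoRegret.{u, v, w} alg M COL c₀ 𝒞 P.δ (P.K * P.m) →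
        ∀ (Ω : Type w) [MeasurableSpace Ω] (μ : MeasureTheory.Measure Ω)
          [MeasureTheory.IsProbabilityMeasure μ] (ℋ 𝒢 : ℕ → MeasurableSpace Ω)
          (π : ℕ → Ω → RLHF.Policy S A) (x : ℕ → Ω → RLHF.Outcome S A),
          RLHF.IsTPORun M P alg μ ℋ 𝒢 π x →
          1 - 2 * P.δ ≤ μ.real {ω | ∀ t : ℕ, P.N ≤ t → t ≤ P.T →
            ∑ i ∈ Finset.range t, M.gap (π i ω) ≤
              P.regOL M C c₀ 𝒞 t +
                C * (∑ i ∈ P.transferSteps t,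
                  P.capΔ M (P.iota M C c₀ 𝒞 (fun j => π j ω) (i + 1)) + P.explore M t) ∧
            ∑ i ∈ P.onlineSteps t, M.gap (π i ω) ≤ P.regOL M C c₀ 𝒞 t ∧
            ∑ i ∈ P.transferSteps t, M.gap (π i ω) ≤
                C * (∑ i ∈ P.transferSteps t,
                  P.capΔ M (P.iota M C c₀ 𝒞 (fun j => π j ω) i) + P.explore M t)} := by
  have hK : 0 < 2 * (3 * c + 8) * (2 : ℝ) ^ c₀ := by positivity
  refine ⟨RLHF.Config.regretConst COL c₀ c, by unfold RLHF.Config.regretConst; linarith, ?_⟩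
  intro S A _ _ _ _ _ _ M P 𝒞 alg hR h𝒞 hgood hsrc hm hN hKpos hδ0 hδ1 hPc hreg Ω _ μ _ ℋ 𝒢 π x
    hrun
  subst hPc
  have hP : P.Admissible M COL c₀ 𝒞 :=
    ⟨hCOL, hc₀, hc, hR, h𝒞, hgood, hsrc, hm, hN, hKpos, hδ0, hδ1⟩
  have hae := hrun.ae_properties hP
  have honline := hreg Ω μ _ _ _ _ (hrun.interaction.online hm hN) hrun.online
  have hconc := hrun.interaction.measure_exists_not_concentrated_le hP
    fun i hi => (hae i hi).mono fun ω hω => hω.1.1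
  have hall : ∀ᵐ ω ∂μ, ∀ i < P.T, RLHF.Bandit.IsPosPolicy (π i ω) ∧
      (i % P.N < P.m → π i ω ∈ RLHF.Bandit.hull P.Pi) ∧
      (P.m ≤ i % P.N → P.IsTPS M (fun j => x j ω) (fun j => π j ω) i (π i ω)) :=
    ae_all_iff.2 fun i => by
      by_cases hi : i < P.T
      · exact (hae i hi).mono fun ω hω _ => hω
      · exact Filter.Eventually.of_forall fun ω h => absurd h hi
  set E₁ := {ω | ∀ t : ℕ, 1 ≤ t → t ≤ P.K * P.m →
      ∑ i ∈ Finset.range t, M.gap (π (P.onlineTime i) ω) ≤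
        COL * M.R * Real.exp (2 * M.R) *
          Real.sqrt (𝒞 * t * Real.log ((P.Pi.card : ℝ) * ((P.K * P.m : ℕ) : ℝ) / P.δ) ^ c₀)}
  set bad := {ω | ¬ ∀ d < P.T, 1 ≤ d →
      P.Concentrated M (fun j => x j ω) (fun j => π j ω) d}
  set null := {ω | ¬ ∀ i < P.T, RLHF.Bandit.IsPosPolicy (π i ω) ∧
      (i % P.N < P.m → π i ω ∈ RLHF.Bandit.hull P.Pi) ∧
      (P.m ≤ i % P.N → P.IsTPS M (fun j => x j ω) (fun j => π j ω) i (π i ω))}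
  have hnull : μ.real null = 0 := by
    rw [MeasureTheory.measureReal_def, ae_iff.1 hall, ENNReal.toReal_zero]
  set target := {ω | ∀ t : ℕ, P.N ≤ t → t ≤ P.T → _}
  have hcover : E₁ ⊆ target ∪ (bad ∪ null) := by
    intro ω hω
    by_cases hb : ω ∈ bad ∪ null
    · exact Or.inr hb
    left
    simp only [Set.mem_union, not_or] at hb
    have hb1 := not_not.1 hb.1
    have hb2 := not_not.1 hb.2
    have hgr : P.GoodRun M COL c₀ 𝒞 (fun j => x j ω) (fun j => π j ω) :=
      ⟨fun i hi => (hb2 i hi).1, fun i hi => (hb2 i hi).2.1, fun i hi => (hb2 i hi).2.2, hb1, hω⟩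
    intro t htN htT
    have hC : 2 * COL ≤ RLHF.Config.regretConst COL c₀ P.c := by
      unfold RLHF.Config.regretConst; linarith
    have h1 := hP.online_regret_le hgr htN htT hC
    have h2 := hP.transfer_regret_le hgr htT (e := 1) le_rfl
    have h3 := hP.transfer_regret_le hgr htT (e := 0) zero_le_one
    refine ⟨?_, h1, h3⟩
    rw [← RLHF.Config.sum_onlineSteps_add_sum_transferSteps (P := P)]
    exact add_le_add h1 h2
  have hle : μ.real E₁ ≤ μ.real target + (μ.real bad + μ.real null) :=
    (measureReal_mono hcover).trans ((measureReal_union_le _ _).trans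
      (add_le_add le_rfl (measureReal_union_le _ _)))
  have honline' : 1 - P.δ ≤ μ.real E₁ := honline
  linarith
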